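/- For $k,v,h\ge 0$ let $D_{k,v,h}$ be the number of partitions of the $2k$ cells of the $2\times k$ array into unordered pairs such that exactly $v$ of the pairs are vertical dominoes (the two cells of one column) and exactly $h$ of the pairs are horizontal dominoes (two cells in the same row and in consecutive columns). Put $$D(y,w,z)=\sum_{k,v,h\ge 0}D_{k,v,h}\,y^kw^vz^h ,$$ a formal power series in $y$ whose coefficients are polynomials in $w,z$; here $w,z$ may be taken as arbitrary elements of any commutative ring. All series below are sums of formal power series in $y$ (coefficientwise), and $(-1)!!=1$. 1. $$D(y,w,z)=\sum_{j=0}^\infty (2j-1)!!\,\frac{y^j\,(1-(1-z)y)^j}{(1+(1-z)y)^j\,(1+(1-w)y-(1-z)^2y^2)^{j+1}} .$$ 2. For real $w,z$, $$D(y,w,z)=\int_0^\infty \frac{e^{-t}\,dt}{\bigl(1+(1-w)y-(1-z)^2y^2\bigr)\sqrt{1-\dfrac{2ty(1-(1-z)y)}{(1+(1-z)y)(1+(1-w)y-(1-z)^2y^2)}}} ,$$ where the integral acts on the Taylor expansion of the integrand in $y$: for each $t$ the integrand is analytic in $y$ at $0$, and for each $k$ its $k$-th Taylor coefficient at $y=0$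 is integrable over $t\in(0,\infty)$ with integral $[y^k]D(y,w,z)$. 3. In particular $$D(y,w,1)=\sum_{j=0}^\infty\frac{(2j-1)!!\,y^j}{(1+(1-w)y)^{j+1}},\qquad D(y,1,z)=\frac1{1-(1-z)y}\sum_{j=0}^\infty\frac{(2j-1)!!\,y^j}{(1+(1-z)y)^{2j+1}},$$ $$D(y,z,z)=\sum_{j=0}^\infty \frac{(2j-1)!!\,y^j\,(1-(1-z)y)^j}{(1+(1-z)y)^j\,(1+(1-z)y-(1-z)^2y^2)^{j+1}} .$$ 4. For $\ell\ge 0$ let $\mathcal F_\ell(y)=\sum_{k\ge0}\bigl(\sum_{h,v\ge 0,\;h+v=k-\ell}D_{k,v,h}\bigr)y^k$. The coefficients of $D(y/z,z,z)$, as a power series in $y$, are Laurent polynomials in $z$ without positive powers of $z$, and $\mathcal F_\ell(y)=[z^{-\ell}]\,D(y/z,z,z)$ for all $\ell\ge 0$. Moreover $$\mathcal F_0=\frac1{1-y-y^2},\qquad \mathcal F_1=\frac{2y^3}{(1-y)(1-y-y^2)^2},\qquad \mathcal F_2=\frac{y^2(1+3y+6y^2+y^3+3y^4)}{(1-y)^2(1-y-y^2)^3}.$$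 -/

import Mathlib

open PowerSeries

noncomputable section

/-- The cells of the `2 × k` array: `(r, i)` is the cell in row `r` and column `i`. -/
abbrev Cell (k : ℕ) : Type := Fin 2 × Fin k

/-- A configuration on the `2 × k` array, the pairs of cards being indistinguishable: a set of
unordered pairs of distinct cells such that every cell lies in exactly one of the pairs. -/
def IsConfiguration {k : ℕ} (M : Finset (Sym2 (Cell k))) : Prop :=
  (∀ e ∈ M, ¬ e.IsDiag) ∧ ∀ c : Cell k, ∃! e, e ∈ M ∧ c ∈ e

/-- A vertical domino: the two cells of one column. -/
def IsVertical {k : ℕ} (e : Sym2 (Cell k)) : Prop :=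
  ∃ i : Fin k, e = s((0, i), (1, i))

/-- A horizontal domino: two cells in the same row and in consecutive columns. -/
def IsHorizontal {k : ℕ} (e : Sym2 (Cell k)) : Prop :=
  ∃ (r : Fin 2) (i j : Fin k), (i : ℕ) + 1 = j ∧ e = s((r, i), (r, j))

open Classical in
/-- The number of vertical dominoes in a set of pairs. -/
def numVertical {k : ℕ} (M : Finset (Sym2 (Cell k))) : ℕ := (M.filter IsVertical).card

open Classical in
/-- The number of horizontal dominoes in a set of pairs. -/
def numHorizontal {k : ℕ} (M : Finset (Sym2 (Cell k))) : ℕ := (M.filter IsHorizontal).card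

open Classical in
/-- `D_{k,v,h}`: the number of configurations on the `2 × k` array with exactly `v` vertical and
exactly `h` horizontal dominoes. -/
def dominoCount (k v h : ℕ) : ℕ :=
  (Finset.univ.filter fun M : Finset (Sym2 (Cell k)) =>
    IsConfiguration M ∧ numVertical M = v ∧ numHorizontal M = h).card

lemma card_of_isConfiguration {k : ℕ} {M : Finset (Sym2 (Cell k))} (hM : IsConfiguration M) :
    M.card = k := by
  classical
  have h1 : ∑ e ∈ M, e.toFinset.card = ∑ _e ∈ M, 2 :=
    Finset.sum_congr rfl fun e he => Sym2.card_toFinset_of_not_isDiag e (hM.1 e he)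
  have h2 : (Finset.univ : Finset (Cell k)) = M.biUnion fun e => e.toFinset := by
    ext c
    obtain ⟨e, he, -⟩ := hM.2 c
    simp only [Finset.mem_univ, Finset.mem_biUnion, Sym2.mem_toFinset, true_iff]
    exact ⟨e, he.1, he.2⟩
  have h3 : (M.biUnion fun e => e.toFinset).card = ∑ e ∈ M, e.toFinset.card := by
    refine Finset.card_biUnion fun e he f hf hne => ?_
    refine Finset.disjoint_left.2 fun c hc hc' => ?_
    rw [Sym2.mem_toFinset] at hc hc'
    exact hne ((hM.2 c).unique ⟨he, hc⟩ ⟨hf, hc'⟩)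
  have h4 : (Finset.univ : Finset (Cell k)).card = 2 * k := by simp
  rw [h2, h3, h1, Finset.sum_const, smul_eq_mul] at h4
  omega

/-- `D_{k,v,h}` vanishes for `v + h > k`, so that the finite sums over `v, h ≤ k` below are the
sums over all `v, h ≥ 0`. -/
lemma dominoCount_eq_zero {k v h : ℕ} (hk : k < v + h) : dominoCount k v h = 0 := by
  classical
  rw [dominoCount, Finset.card_eq_zero, Finset.filter_eq_empty_iff]
  rintro M - ⟨hM, rfl, rfl⟩
  have hdisj : Disjoint (M.filter IsVertical) (M.filter IsHorizontal) := by
    rw [Finset.disjoint_filter]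
    rintro e - ⟨i, rfl⟩ ⟨r, a, b, hab, h⟩
    rw [Sym2.eq_iff] at h
    rcases h with ⟨h, h'⟩ | ⟨h, h'⟩ <;> simp only [Prod.mk.injEq] at h h' <;> omega
  have hle := Finset.card_le_card
    (Finset.union_subset (Finset.filter_subset IsVertical M) (Finset.filter_subset IsHorizontal M))
  rw [Finset.card_union_of_disjoint hdisj, card_of_isConfiguration hM] at hle
  unfold numVertical numHorizontal at hk
  omega

/-- The polynomial `∑_{v,h ≥ 0} D_{k,v,h} w^v z^h`, at elements `w, z` of a commutative ring. -/
def dominoPoly {R : Type*} [CommRing R] (w z : R) (k : ℕ) : R :=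
  ∑ v ∈ Finset.range (k + 1), ∑ h ∈ Finset.range (k + 1), (dominoCount k v h : R) * w ^ v * z ^ h

/-- The generating function `D(y,w,z) = ∑_{k,v,h ≥ 0} D_{k,v,h} y^k w^v z^h`, as a formal power
series in `y`; the variables `w` and `z` are elements of an arbitrary commutative ring `R`
(for instance the two indeterminates of a polynomial ring). -/
def dominoGF {R : Type*} [CommRing R] (w z : R) : R⟦X⟧ := PowerSeries.mk (dominoPoly w z)

/-- The reciprocal of a formal power series with constant coefficient `1`. -/
def recip {R : Type*} [CommRing R] (f : R⟦X⟧) : R⟦X⟧ := PowerSeries.invOfUnit f 1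

lemma mul_recip {R : Type*} [CommRing R] (f : R⟦X⟧) (hf : constantCoeff f = 1) :
    f * recip f = 1 :=
  PowerSeries.mul_invOfUnit f 1 (by simpa using hf)

open scoped PowerSeries.WithPiTopology in
/-- `∑_j f j = S` as formal power series: convergence of the coefficients, where `R` is given the
discrete topology. -/
def HasFormalSum {R : Type*} [CommRing R] (f : ℕ → R⟦X⟧) (S : R⟦X⟧) : Prop :=
  letI : TopologicalSpace R := ⊥
  HasSum f S

/-- `(2j-1)!!` as a constant power series, with `(-1)!! = 1` (for `j = 0` the truncated subtraction
gives `0!! = 1`). -/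
def oddFactorial {R : Type*} [CommRing R] (j : ℕ) : R⟦X⟧ :=
  ((Nat.doubleFactorial (2 * j - 1) : ℕ) : R⟦X⟧)

/-- The integrand without its factor `e^{-t}`, as a real function of `t` and `y`. -/
def laplaceKernel (w z t y : ℝ) : ℝ :=
  1 / ((1 + (1 - w) * y - (1 - z) ^ 2 * y ^ 2) *
    √(1 - 2 * t * y * (1 - (1 - z) * y) /
      ((1 + (1 - z) * y) * (1 + (1 - w) * y - (1 - z) ^ 2 * y ^ 2))))

/-- `[y^k] f(y)`, the coefficient of `y^k` in the Taylor expansion of `f` at `0`. -/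
def taylorCoeff (k : ℕ) (f : ℝ → ℝ) : ℝ := iteratedDeriv k f 0 / (k.factorial : ℝ)

/-- `𝓕_ℓ(y) = ∑_k (∑_{v+h=k-ℓ} D_{k,v,h}) y^k`, the generating function of the
`(k-ℓ)`-domino configurations. -/
def dominoF (l : ℕ) : ℤ⟦X⟧ :=
  PowerSeries.mk fun k =>
    if l ≤ k then ∑ p ∈ Finset.HasAntidiagonal.antidiagonal (k - l), (dominoCount k p.1 p.2 : ℤ) else 0

/-- `D(y/z,z,z)`, a formal power series in `y` over the Laurent polynomials in `z`. -/
def dominoGFDiv : (LaurentPolynomial ℤ)⟦X⟧ :=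
  PowerSeries.rescale (LaurentPolynomial.T (-1))
    (dominoGF (LaurentPolynomial.T 1) (LaurentPolynomial.T 1))

end

/-! Give a vertical domino the weight `w`, a horizontal one `z`, and any other pair `s`. The sum
over configurations of the product of weights is a hafnian on the complete graph on the `2k` cells.
Writing the weights as `s` plus a correction supported on dominoes (`w - s` and `z - s`) and
expanding, one chooses a set of disjoint dominoes with the corrected weights and completes it
arbitrarily: if `2j` cells remain, there are `(2j-1)!!` completions, each of weight `s^j`
(`hafnian_const_add`). What is left is to count weighted partial domino matchings of a ladder.

With `a = w - s`, `b = z - s`, deleting cells at the end of the ladder gives linear recurrences, and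
the series for `2j` uncovered cells is `y^j (1+by)^j / ((1-by)^j (1-ay-b²y²)^(j+1))`
(`gridSeries_mul`). At `s = 1` this gives the series for `D`; it converges formally because the
`j`-th term is divisible by `y^j`. The specialisations at `w = 1` or `z = 1` are cancellations.

For the integral, `∑ (2j-1)!!/j! x^j = 1/√(1-2x)`, and integrating `t^j` against `e^{-t}` restores
`j!`. The Taylor series of the kernel is identified through its square and its constant term
(`taylorSeries_laplaceKernel`).

For `𝓕_ℓ`, keep `s` as a variable and set `w = z = 1`: the coefficient of `s^ℓ` counts
configurations with exactly `ℓ` non-dominoes. The factor `s^j` leaves only `j ≤ ℓ`, so each `𝓕_ℓ` is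
a finite sum of rational functions (`dominoF_eq_sum_layer`). -/

noncomputable section

/-! ### Hafnians and matching polynomials of weighted complete graphs -/

section Hafnian

variable {V V' R : Type*} [CommRing R]

/-- `M` is a perfect matching of the complete graph on the finite set `s`. -/
def IsPerfectMatchingOn (s : Finset V) (M : Finset (Sym2 V)) : Prop :=
  (∀ e ∈ M, ¬ e.IsDiag ∧ ∀ c ∈ e, c ∈ s) ∧ ∀ c ∈ s, ∃! e, e ∈ M ∧ c ∈ e

open Classical in
/-- The finite set of perfect matchings of the complete graph on `s`. -/
def perfectMatchings (s : Finset V) : Finset (Finset (Sym2 V)) :=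
  s.sym2.powerset.filter fun M => IsPerfectMatchingOn s M

lemma mem_perfectMatchings {s : Finset V} {M : Finset (Sym2 V)} :
    M ∈ perfectMatchings s ↔ IsPerfectMatchingOn s M := by
  classical
  rw [perfectMatchings, Finset.mem_filter, Finset.mem_powerset, and_iff_right_iff_imp]
  intro h e he
  exact Finset.mem_sym2_iff.2 (h.1 e he).2

/-- The hafnian of the weights `W` restricted to `s`: the sum over all perfect matchings of `s` of
the product of the weights of the pairs. -/
def hafnian (W : Sym2 V → R) (s : Finset V) : R :=
  ∑ M ∈ perfectMatchings s, ∏ e ∈ M, W e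

lemma hafnian_empty (W : Sym2 V → R) : hafnian W ∅ = 1 := by
  have : perfectMatchings (∅ : Finset V) = {∅} := by
    ext M
    rw [mem_perfectMatchings, Finset.mem_singleton]
    constructor
    · rintro ⟨h, -⟩
      refine Finset.eq_empty_of_forall_notMem fun e he => ?_
      induction e using Sym2.ind with
      | _ x y => exact absurd ((h _ he).2 x (Sym2.mem_mk_left x y)) (Finset.notMem_empty x)
    · rintro rfl
      exact ⟨by simp, by simp⟩
  simp [hafnian, this]

variable [DecidableEq V]

lemma IsPerfectMatchingOn.insert_pair {s : Finset V} {v u : V} (hv : v ∉ s) (hu : u ∈ s)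
    {M : Finset (Sym2 V)} (hM : IsPerfectMatchingOn (s.erase u) M) :
    IsPerfectMatchingOn (insert v s) (insert s(v, u) M) := by
  have hvu : v ≠ u := fun h => hv (h ▸ hu)
  have hvM : ∀ e ∈ M, v ∉ e := fun e he h =>
    hv (Finset.mem_of_mem_erase ((hM.1 e he).2 v h))
  have huM : ∀ e ∈ M, u ∉ e := fun e he h => by
    simpa using (hM.1 e he).2 u h
  refine ⟨?_, ?_⟩
  · intro e he
    rcases Finset.mem_insert.1 he with rfl | he
    · refine ⟨by simpa using hvu, fun c hc => ?_⟩
      rcases Sym2.mem_iff.1 hc with rfl | rfl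
      · simp
      · simp [hu]
    · exact ⟨(hM.1 e he).1, fun c hc =>
        Finset.mem_insert_of_mem (Finset.mem_of_mem_erase ((hM.1 e he).2 c hc))⟩
  · intro c hc
    by_cases hcvu : c ∈ s(v, u)
    · refine ⟨s(v, u), ⟨by simp, hcvu⟩, ?_⟩
      rintro f ⟨hf, hcf⟩
      rcases Finset.mem_insert.1 hf with rfl | hfM
      · rfl
      · rcases Sym2.mem_iff.1 hcvu with rfl | rfl
        · exact absurd hcf (hvM f hfM)
        · exact absurd hcf (huM f hfM)
    · have hcv : c ≠ v ∧ c ≠ u := by simpa [Sym2.mem_iff, not_or] using hcvu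
      obtain ⟨e, ⟨he, hce⟩, huniq⟩ := hM.2 c
        (Finset.mem_erase.2 ⟨hcv.2, (Finset.mem_insert.1 hc).resolve_left hcv.1⟩)
      refine ⟨e, ⟨Finset.mem_insert_of_mem he, hce⟩, ?_⟩
      rintro f ⟨hf, hcf⟩
      rcases Finset.mem_insert.1 hf with rfl | hf
      · exact absurd hcf hcvu
      · exact huniq f ⟨hf, hcf⟩

lemma IsPerfectMatchingOn.erase_pair {s : Finset V} {v u : V} (hv : v ∉ s)
    {M : Finset (Sym2 V)} (hM : IsPerfectMatchingOn (insert v s) M) (hvu : s(v, u) ∈ M) :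
    IsPerfectMatchingOn (s.erase u) (M.erase s(v, u)) := by
  have huM := (hM.1 _ hvu).2 u (Sym2.mem_mk_right v u)
  have hvM := (hM.1 _ hvu).2 v (Sym2.mem_mk_left v u)
  refine ⟨?_, ?_⟩
  · intro e he
    obtain ⟨hne, heM⟩ := Finset.mem_erase.1 he
    refine ⟨(hM.1 e heM).1, fun c hc => Finset.mem_erase.2 ⟨?_, ?_⟩⟩
    · rintro rfl
      exact hne ((hM.2 c huM).unique ⟨heM, hc⟩ ⟨hvu, Sym2.mem_mk_right v c⟩)
    · refine (Finset.mem_insert.1 ((hM.1 e heM).2 c hc)).resolve_left ?_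
      rintro rfl
      exact hne ((hM.2 c hvM).unique ⟨heM, hc⟩ ⟨hvu, Sym2.mem_mk_left c u⟩)
  · intro c hc
    obtain ⟨hcu, hcs⟩ := Finset.mem_erase.1 hc
    have hcv : c ≠ v := fun h => hv (h ▸ hcs)
    obtain ⟨e, ⟨he, hce⟩, huniq⟩ := hM.2 c (Finset.mem_insert_of_mem hcs)
    refine ⟨e, ⟨Finset.mem_erase.2 ⟨?_, he⟩, hce⟩, fun f hf =>
      huniq f ⟨Finset.mem_of_mem_erase hf.1, hf.2⟩⟩
    rintro rfl
    rcases Sym2.mem_iff.1 hce with h | h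
    · exact hcv h
    · exact hcu h

/-- Expansion of the hafnian along the pair that contains `v`. -/
lemma hafnian_insert (W : Sym2 V → R) {v : V} {s : Finset V} (hv : v ∉ s) :
    hafnian W (insert v s) = ∑ u ∈ s, W s(v, u) * hafnian W (s.erase u) := by
  simp only [hafnian, Finset.mul_sum]
  rw [Finset.sum_sigma']
  symm
  have hnot : ∀ u ∈ s, ∀ M ∈ perfectMatchings (s.erase u), ∀ x, s(v, x) ∉ M := by
    intro u _ M hM x h
    exact hv (Finset.mem_of_mem_erase
      (((mem_perfectMatchings.1 hM).1 _ h).2 v (Sym2.mem_mk_left v x)))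
  refine Finset.sum_bij (fun p _ => insert s(v, p.1) p.2) ?_ ?_ ?_ ?_
  · rintro ⟨u, M⟩ h
    rw [Finset.mem_sigma] at h
    exact mem_perfectMatchings.2 ((mem_perfectMatchings.1 h.2).insert_pair hv h.1)
  · rintro ⟨u, M⟩ h ⟨u', M'⟩ h' heq
    rw [Finset.mem_sigma] at h h'
    dsimp only at heq h h'
    have huu : u = u' := by
      have : s(v, u) ∈ insert s(v, u') M' := heq ▸ Finset.mem_insert_self _ _
      rcases Finset.mem_insert.1 this with h1 | h1
      · exact Sym2.congr_right.1 h1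
      · exact absurd h1 (hnot u' h'.1 M' h'.2 u)
    subst huu
    have : M = M' := by
      rw [← Finset.erase_insert (hnot u h.1 M h.2 u), heq,
        Finset.erase_insert (hnot u h'.1 M' h'.2 u)]
    rw [this]
  · intro M hM
    rw [mem_perfectMatchings] at hM
    obtain ⟨e, ⟨he, hve⟩, -⟩ := hM.2 v (Finset.mem_insert_self v s)
    obtain ⟨u, rfl⟩ := Sym2.mem_iff_exists.1 hve
    have hus : u ∈ s := by
      refine (Finset.mem_insert.1 ((hM.1 _ he).2 u (Sym2.mem_mk_right v u))).resolve_left ?_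
      rintro rfl
      exact (hM.1 _ he).1 (by simp)
    exact ⟨⟨u, M.erase s(v, u)⟩, Finset.mem_sigma.2
      ⟨hus, mem_perfectMatchings.2 (hM.erase_pair hv he)⟩, Finset.insert_erase he⟩
  · rintro ⟨u, M⟩ h
    rw [Finset.mem_sigma] at h
    rw [Finset.prod_insert (hnot u h.1 M h.2 u)]

/-- Used to place the arrays for all `k` inside one infinite strip, where grids of different lengths
can be compared. -/
lemma hafnian_map [DecidableEq V'] (W : Sym2 V' → R) (f : V ↪ V') (s : Finset V) :
    hafnian W (s.map f) = hafnian (fun e => W (e.map f)) s := by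
  induction s using Finset.strongInduction with
  | H s ih =>
    rcases s.eq_empty_or_nonempty with rfl | ⟨v, hv⟩
    · simp [hafnian_empty]
    · obtain ⟨t, hvt, rfl⟩ : ∃ t, v ∉ t ∧ insert v t = s :=
        ⟨s.erase v, Finset.notMem_erase v s, Finset.insert_erase hv⟩
      rw [hafnian_insert _ hvt, Finset.map_insert, hafnian_insert _ (by simpa using hvt),
        Finset.sum_map]
      refine Finset.sum_congr rfl fun u hu => ?_
      rw [← Finset.map_erase, ih _ ((Finset.erase_ssubset hu).trans (Finset.ssubset_insert hvt)),
        Sym2.map_mk]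

/-- Summing over a subset of `s` and one of its elements, in either order. -/
lemma sum_powerset_sum_erase {A : Type*} [AddCommMonoid A] (s : Finset V)
    (F : V → Finset V → A) :
    ∑ T ∈ s.powerset, ∑ u ∈ T, F u (T.erase u) =
      ∑ u ∈ s, ∑ T ∈ (s.erase u).powerset, F u T := by
  rw [Finset.sum_sigma', Finset.sum_sigma']
  refine Finset.sum_bij' (fun p _ => ⟨p.2, p.1.erase p.2⟩) (fun p _ => ⟨insert p.1 p.2, p.1⟩)
    ?_ ?_ ?_ ?_ ?_
  · rintro ⟨T, u⟩ h
    simp only [Finset.mem_sigma, Finset.mem_powerset] at h ⊢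
    exact ⟨h.1 h.2, Finset.erase_subset_erase _ h.1⟩
  · rintro ⟨u, T⟩ h
    simp only [Finset.mem_sigma, Finset.mem_powerset] at h ⊢
    exact ⟨Finset.insert_subset h.1 (h.2.trans (Finset.erase_subset _ _)),
      Finset.mem_insert_self _ _⟩
  · rintro ⟨T, u⟩ h
    simp only [Finset.mem_sigma, Finset.mem_powerset] at h
    simp [Finset.insert_erase h.2]
  · rintro ⟨u, T⟩ h
    simp only [Finset.mem_sigma, Finset.mem_powerset] at h
    have : u ∉ T := fun hu => by simpa using h.2 hu
    simp [Finset.erase_insert this]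
  · intros; rfl

/-- Subsets of `s` paired with an element of the complement, in either order. -/
lemma sum_powerset_sum_sdiff {A : Type*} [AddCommMonoid A] (s : Finset V)
    (F : V → Finset V → A) :
    ∑ T ∈ s.powerset, ∑ u ∈ s \ T, F u T = ∑ u ∈ s, ∑ T ∈ (s.erase u).powerset, F u T := by
  refine Finset.sum_comm' fun T u => ?_
  simp only [Finset.mem_powerset, Finset.mem_sdiff, Finset.subset_erase]
  tauto

/-- Expanding the product over a matching labels each pair `W` or `W'`; `T` is the set of vertices
covered by the pairs labelled `W`. The induction expands along a vertex `v`, the cases `v ∉ T` and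
`v ∈ T` giving the two summands of the weight of its pair. -/
lemma hafnian_add (W W' : Sym2 V → R) (s : Finset V) :
    hafnian (fun e => W e + W' e) s =
      ∑ T ∈ s.powerset, hafnian W T * hafnian W' (s \ T) := by
  induction s using Finset.strongInduction with
  | H s ih =>
    rcases s.eq_empty_or_nonempty with rfl | ⟨v, hv⟩
    · simp [hafnian_empty]
    · obtain ⟨t, hvt, rfl⟩ : ∃ t, v ∉ t ∧ insert v t = s :=
        ⟨s.erase v, Finset.notMem_erase v s, Finset.insert_erase hv⟩
      have h1 : ∀ T ∈ t.powerset, hafnian W T * hafnian W' (insert v t \ T) =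
          ∑ u ∈ t \ T, W' s(v, u) * (hafnian W T * hafnian W' (t.erase u \ T)) := by
        intro T hT
        rw [Finset.mem_powerset] at hT
        rw [Finset.insert_sdiff_of_notMem _ (fun h => hvt (hT h)),
          hafnian_insert _ (fun h => hvt (Finset.mem_sdiff.1 h).1), Finset.mul_sum]
        refine Finset.sum_congr rfl fun u _ => ?_
        rw [Finset.erase_sdiff_comm]
        ring
      have h2 : ∀ T ∈ t.powerset, hafnian W (insert v T) * hafnian W' (insert v t \ insert v T) =
          ∑ u ∈ T, W s(v, u) * (hafnian W (T.erase u) *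
            hafnian W' (t.erase u \ T.erase u)) := by
        intro T hT
        rw [Finset.mem_powerset] at hT
        rw [hafnian_insert _ (fun h => hvt (hT h)), Finset.sum_mul,
          Finset.insert_sdiff_insert, Finset.sdiff_insert_of_notMem hvt]
        refine Finset.sum_congr rfl fun u hu => ?_
        have : t.erase u \ T.erase u = t \ T := by
          ext x
          simp only [Finset.mem_sdiff, Finset.mem_erase]
          by_cases hx : x = u
          · subst hx; simp [hu]
          · simp [hx]
        rw [this]
        ring
      rw [Finset.sum_powerset_insert hvt, Finset.sum_congr rfl h1, Finset.sum_congr rfl h2,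
        sum_powerset_sum_sdiff t
          (fun u T => W' s(v, u) * (hafnian W T * hafnian W' (t.erase u \ T))),
        sum_powerset_sum_erase t
          (fun u T => W s(v, u) * (hafnian W T * hafnian W' (t.erase u \ T))),
        ← Finset.sum_add_distrib, hafnian_insert _ hvt]
      refine Finset.sum_congr rfl fun u hu => ?_
      rw [ih _ ((Finset.erase_ssubset hu).trans (Finset.ssubset_insert hvt)), ← Finset.mul_sum,
        ← Finset.mul_sum]
      ring

lemma hafnian_const (c : R) (n : ℕ) : ∀ s : Finset V,
    (s.card = 2 * n → hafnian (fun _ => c) s = (Nat.doubleFactorial (2 * n - 1) : ℕ) * c ^ n) ∧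
    (s.card = 2 * n + 1 → hafnian (fun _ => c) s = 0) := by
  have hrec : ∀ (s : Finset V) (m : ℕ), s.card = m + 2 → ∀ x : R,
      (∀ t : Finset V, t.card = m → hafnian (fun _ => c) t = x) →
      hafnian (fun _ => c) s = (m + 1) * (c * x) := by
    intro s m hs x hx
    obtain ⟨v, hv⟩ : s.Nonempty := Finset.card_pos.1 (by omega)
    obtain ⟨t, hvt, rfl⟩ : ∃ t, v ∉ t ∧ insert v t = s :=
      ⟨s.erase v, Finset.notMem_erase v s, Finset.insert_erase hv⟩
    rw [Finset.card_insert_of_notMem hvt] at hs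
    rw [hafnian_insert _ hvt, Finset.sum_congr rfl fun u hu => by
      rw [hx (t.erase u) (by rw [Finset.card_erase_of_mem hu]; omega)], Finset.sum_const,
      show t.card = m + 1 by omega, nsmul_eq_mul]
    push_cast
    rfl
  induction n with
  | zero =>
    intro s
    refine ⟨fun h => ?_, fun h => ?_⟩
    · rw [Finset.card_eq_zero.1 h]
      simp [hafnian_empty]
    · obtain ⟨v, rfl⟩ := Finset.card_eq_one.1 h
      have := hafnian_insert (fun _ => c) (Finset.notMem_empty v)
      simpa using this
  | succ n ih =>
    intro s
    refine ⟨fun h => ?_, fun h => ?_⟩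
    · rw [hrec s (2 * n) (by omega) _ fun t => (ih t).1, pow_succ]
      -- The case `n = 0` is separate because the subtraction in `2 * n - 1` truncates there.
      rcases n with _ | n
      · simp
      · rw [show 2 * (n + 1 + 1) - 1 = (2 * (n + 1) - 1) + 2 by omega,
          Nat.doubleFactorial_add_two, show 2 * (n + 1) - 1 + 2 = 2 * (n + 1) + 1 by omega]
        push_cast
        ring
    · rw [hrec s (2 * n + 1) (by omega) _ fun t => (ih t).2]
      simp

/-- The matching polynomial: the sum over all matchings of the product of the weights of the pairs
times `X` to the number of uncovered vertices. -/
def matchingPoly (W : Sym2 V → R) (s : Finset V) : Polynomial R :=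
  ∑ T ∈ s.powerset, Polynomial.C (hafnian W T) * Polynomial.X ^ (s \ T).card

lemma matchingPoly_empty (W : Sym2 V → R) : matchingPoly W ∅ = 1 := by
  simp [matchingPoly, hafnian_empty]

/-- Either `v` is uncovered, which contributes the factor `X`, or it is paired with some `u`. -/
lemma matchingPoly_insert (W : Sym2 V → R) {v : V} {s : Finset V} (hv : v ∉ s) :
    matchingPoly W (insert v s) = Polynomial.X * matchingPoly W s +
      ∑ u ∈ s, Polynomial.C (W s(v, u)) * matchingPoly W (s.erase u) := by
  have h1 : ∀ T ∈ s.powerset,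
      Polynomial.C (hafnian W T) * Polynomial.X ^ (insert v s \ T).card =
        Polynomial.X * (Polynomial.C (hafnian W T) * Polynomial.X ^ (s \ T).card) := by
    intro T hT
    rw [Finset.mem_powerset] at hT
    rw [Finset.insert_sdiff_of_notMem _ (fun h => hv (hT h)),
      Finset.card_insert_of_notMem (fun h => hv (Finset.mem_sdiff.1 h).1)]
    ring
  have h2 : ∀ T ∈ s.powerset,
      Polynomial.C (hafnian W (insert v T)) * Polynomial.X ^ (insert v s \ insert v T).card =
        ∑ u ∈ T, Polynomial.C (W s(v, u)) * (Polynomial.C (hafnian W (T.erase u)) *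
          Polynomial.X ^ (s.erase u \ T.erase u).card) := by
    intro T hT
    rw [Finset.mem_powerset] at hT
    rw [hafnian_insert _ (fun h => hv (hT h)), map_sum, Finset.sum_mul,
      Finset.insert_sdiff_insert, Finset.sdiff_insert_of_notMem hv]
    refine Finset.sum_congr rfl fun u hu => ?_
    have : s.erase u \ T.erase u = s \ T := by
      ext x
      simp only [Finset.mem_sdiff, Finset.mem_erase]
      by_cases hx : x = u
      · subst hx; simp [hu]
      · simp [hx]
    rw [this, map_mul]
    ring
  rw [matchingPoly, Finset.sum_powerset_insert hv, Finset.sum_congr rfl h1,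
    Finset.sum_congr rfl h2, ← Finset.mul_sum, sum_powerset_sum_erase s
      (fun u T => Polynomial.C (W s(v, u)) * (Polynomial.C (hafnian W T) *
        Polynomial.X ^ (s.erase u \ T).card))]
  simp only [matchingPoly, Finset.mul_sum]

/-- Adding a constant `c` to all weights completes each matching to all perfect matchings that
contain it. -/
lemma hafnian_const_add (c : R) (W : Sym2 V → R) (s : Finset V) (k : ℕ) (hs : s.card = 2 * k) :
    hafnian (fun e => W e + c) s =
      ∑ j ∈ Finset.range (k + 1), ((Nat.doubleFactorial (2 * j - 1) : ℕ) : R) * c ^ j *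
        (matchingPoly W s).coeff (2 * j) := by
  rw [hafnian_add]
  simp only [matchingPoly, Polynomial.finsetSum_coeff, Polynomial.coeff_C_mul_X_pow,
    Finset.mul_sum]
  rw [Finset.sum_comm]
  refine Finset.sum_congr rfl fun T hT => ?_
  have hle : (s \ T).card ≤ 2 * k := hs ▸ Finset.card_le_card Finset.sdiff_subset
  -- The uncovered set `s \ T` singles out `j = n` when its size is `2 * n`; when the size is odd it
  -- has no perfect matching, and no power `X ^ (2 * j)` matches either.
  obtain ⟨n, hn | hn⟩ := Nat.even_or_odd' (s \ T).card
  · rw [((hafnian_const c n (s \ T)).1 hn), hn,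
      Finset.sum_eq_single_of_mem n (Finset.mem_range.2 (by omega))]
    · simp [mul_comm]
    · intro j _ hj
      rw [if_neg (by omega), mul_zero]
  · rw [((hafnian_const c n (s \ T)).2 hn), hn, mul_zero, Finset.sum_eq_zero]
    intro j _
    rw [if_neg (by omega), mul_zero]

end Hafnian

/-! ### Partial domino matchings of the ladder -/

section Grid

variable {R : Type*} [CommRing R]

/-- The two cells of one column of the two-row strip with columns indexed by `ℕ`. -/
def IsVerticalPair (e : Sym2 (Fin 2 × ℕ)) : Prop :=
  ∃ i : ℕ, e = s((0, i), (1, i))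

/-- Two cells in the same row and in consecutive columns of the two-row strip. -/
def IsHorizontalPair (e : Sym2 (Fin 2 × ℕ)) : Prop :=
  ∃ (r : Fin 2) (i : ℕ), e = s((r, i), (r, i + 1))

open Classical in
/-- The weight on pairs of cells that is `a` on vertical dominoes, `b` on horizontal dominoes and
zero elsewhere. -/
def dominoWeight (a b : R) (e : Sym2 (Fin 2 × ℕ)) : R :=
  if IsVerticalPair e then a else if IsHorizontalPair e then b else 0

lemma isVerticalPair_mk {r r' : Fin 2} {i j : ℕ} :
    IsVerticalPair s((r, i), (r', j)) ↔ r ≠ r' ∧ i = j := by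
  simp only [IsVerticalPair, Sym2.eq_iff, Prod.mk.injEq]
  constructor
  · rintro ⟨l, ⟨⟨rfl, rfl⟩, rfl, rfl⟩ | ⟨⟨rfl, rfl⟩, rfl, rfl⟩⟩ <;> simp
  · rintro ⟨h, rfl⟩
    refine ⟨i, ?_⟩
    fin_cases r <;> fin_cases r' <;> simp_all

lemma isHorizontalPair_mk {r r' : Fin 2} {i j : ℕ} :
    IsHorizontalPair s((r, i), (r', j)) ↔ r = r' ∧ (i + 1 = j ∨ j + 1 = i) := by
  simp only [IsHorizontalPair, Sym2.eq_iff, Prod.mk.injEq]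
  constructor
  · rintro ⟨r, l, ⟨⟨rfl, rfl⟩, rfl, rfl⟩ | ⟨⟨rfl, rfl⟩, rfl, rfl⟩⟩ <;> simp
  · rintro ⟨rfl, rfl | rfl⟩
    · exact ⟨r, i, by simp⟩
    · exact ⟨r, j, by simp⟩

lemma dominoWeight_vertical (a b : R) {r r' : Fin 2} (h : r ≠ r') (i : ℕ) :
    dominoWeight a b s((r, i), (r', i)) = a := by
  rw [dominoWeight, if_pos (isVerticalPair_mk.2 ⟨h, rfl⟩)]

lemma dominoWeight_horizontal (a b : R) (r : Fin 2) (i : ℕ) :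
    dominoWeight a b s((r, i + 1), (r, i)) = b := by
  rw [dominoWeight, if_neg (by rw [isVerticalPair_mk]; simp),
    if_pos (isHorizontalPair_mk.2 ⟨rfl, Or.inr rfl⟩)]

lemma dominoWeight_eq_zero (a b : R) {r r' : Fin 2} {i j : ℕ} (h : j < i)
    (h' : r ≠ r' ∨ j + 1 ≠ i) : dominoWeight a b s((r, i), (r', j)) = 0 := by
  rw [dominoWeight, if_neg (by rw [isVerticalPair_mk]; omega),
    if_neg (by rw [isHorizontalPair_mk]; rintro ⟨rfl, h1 | h1⟩ <;> simp_all; omega)]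

/-- The first `k` columns of the two-row strip. -/
def grid (k : ℕ) : Finset (Fin 2 × ℕ) := Finset.univ ×ˢ Finset.range k

lemma mem_grid {k : ℕ} {r : Fin 2} {i : ℕ} : (r, i) ∈ grid k ↔ i < k := by
  simp [grid]

lemma grid_succ (k : ℕ) {r r' : Fin 2} (h : r ≠ r') :
    grid (k + 1) = insert (r, k) (insert (r', k) (grid k)) := by
  ext ⟨q, i⟩
  simp only [mem_grid, Finset.mem_insert, Prod.mk.injEq]
  have : q = r ∨ q = r' := by omega
  constructor
  · intro hi
    rcases Nat.lt_succ_iff_lt_or_eq.1 hi with hi | rfl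
    · exact Or.inr (Or.inr hi)
    · rcases this with rfl | rfl <;> simp
  · rintro (⟨-, rfl⟩ | ⟨-, rfl⟩ | hi) <;> omega

lemma matchingPoly_insert_grid_succ (a b : R) (r r' : Fin 2) (h : r ≠ r') (k : ℕ) :
    matchingPoly (dominoWeight a b) (insert (r, k + 1) (grid (k + 1))) =
      Polynomial.X * matchingPoly (dominoWeight a b) (grid (k + 1)) +
        Polynomial.C b * matchingPoly (dominoWeight a b) (insert (r', k) (grid k)) := by
  rw [matchingPoly_insert _ (by simp [mem_grid]), Finset.sum_eq_single_of_mem (r, k)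
    (by simp [mem_grid])]
  · rw [dominoWeight_horizontal, grid_succ k h, Finset.erase_insert]
    simp [mem_grid, h]
  · rintro ⟨q, i⟩ hq hne
    rw [mem_grid] at hq
    rw [dominoWeight_eq_zero a b hq, map_zero, zero_mul]
    by_contra! hcon
    exact hne (by rw [← hcon.1, ← Nat.succ_injective hcon.2])

/-- The symmetry exchanging the two rows, obtained from the recurrence. It lets a single auxiliary
sequence `gridPolyExtra` suffice. -/
lemma matchingPoly_insert_grid_row (a b : R) (k : ℕ) (r r' : Fin 2) :
    matchingPoly (dominoWeight a b) (insert (r, k) (grid k)) =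
      matchingPoly (dominoWeight a b) (insert (r', k) (grid k)) := by
  induction k generalizing r r' with
  | zero =>
    have : grid 0 = ∅ := by simp [grid]
    rw [this, matchingPoly_insert _ (Finset.notMem_empty _),
      matchingPoly_insert _ (Finset.notMem_empty _), Finset.sum_empty, Finset.sum_empty]
  | succ k ih =>
    rw [matchingPoly_insert_grid_succ a b r (1 - r) (by omega),
      matchingPoly_insert_grid_succ a b r' (1 - r') (by omega), ih (1 - r) (1 - r')]

/-- The matching polynomial of the `2 × k` grid with weighted dominoes as pairs. -/
def gridPoly (a b : R) (k : ℕ) : Polynomial R := matchingPoly (dominoWeight a b) (grid k)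

/-- The matching polynomial of the `2 × k` grid with one additional cell in the next column. -/
def gridPolyExtra (a b : R) (k : ℕ) : Polynomial R :=
  matchingPoly (dominoWeight a b) (insert (1, k) (grid k))

lemma gridPoly_zero (a b : R) : gridPoly a b 0 = 1 := by
  rw [gridPoly, show grid 0 = ∅ by simp [grid], matchingPoly_empty]

lemma gridPolyExtra_zero (a b : R) : gridPolyExtra a b 0 = Polynomial.X := by
  rw [gridPolyExtra, show grid 0 = ∅ by simp [grid], matchingPoly_insert _ (by simp),
    matchingPoly_empty]
  simp

lemma gridPolyExtra_succ (a b : R) (k : ℕ) :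
    gridPolyExtra a b (k + 1) =
      Polynomial.X * gridPoly a b (k + 1) + Polynomial.C b * gridPolyExtra a b k := by
  rw [gridPolyExtra, matchingPoly_insert_grid_succ a b 1 0 (by decide),
    matchingPoly_insert_grid_row a b k 0 1, gridPoly, gridPolyExtra]

lemma gridPoly_one (a b : R) :
    gridPoly a b 1 = Polynomial.X * gridPolyExtra a b 0 + Polynomial.C a * gridPoly a b 0 := by
  have h0 : grid 0 = ∅ := by simp [grid]
  rw [gridPoly, gridPoly, gridPolyExtra, grid_succ 0 (show (0 : Fin 2) ≠ 1 by decide), h0,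
    matchingPoly_insert _ (by simp)]
  simp [dominoWeight_vertical, matchingPoly_empty]

/-- The cell `(0, k + 1)` is uncovered, in a vertical domino, or paired with `(0, k)`. In the last
case row `1` overhangs `grid k` by two cells, and its end cell is either uncovered or paired with
its neighbour. -/
lemma gridPoly_add_two (a b : R) (k : ℕ) :
    gridPoly a b (k + 2) = Polynomial.X * gridPolyExtra a b (k + 1) +
      Polynomial.C a * gridPoly a b (k + 1) + Polynomial.C b *
        (Polynomial.X * gridPolyExtra a b k + Polynomial.C b * gridPoly a b k) := by
  have h01 : (0 : Fin 2) ≠ 1 := by decide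
  have hsub : (insert (1, k + 1) (grid (k + 1))).erase (0, k) =
      insert ((1 : Fin 2), k + 1) (insert ((1 : Fin 2), k) (grid k)) := by
    rw [Finset.erase_insert_of_ne (by simp), grid_succ k h01, Finset.erase_insert]
    simp [mem_grid]
  have hsub' : matchingPoly (dominoWeight a b) ((insert (1, k + 1) (grid (k + 1))).erase (0, k)) =
      Polynomial.X * gridPolyExtra a b k + Polynomial.C b * gridPoly a b k := by
    rw [hsub, matchingPoly_insert _ (by simp [mem_grid]), Finset.sum_eq_single_of_mem (1, k)
      (by simp), dominoWeight_horizontal, Finset.erase_insert (by simp [mem_grid])]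
    · rfl
    · rintro ⟨q, i⟩ hq hne
      have hik : i < k := by simpa [mem_grid, hne] using hq
      rw [dominoWeight_eq_zero a b (by omega) (by omega), map_zero, zero_mul]
  rw [gridPoly, grid_succ (k + 1) h01, matchingPoly_insert _ (by simp [mem_grid]),
    Finset.sum_insert (by simp [mem_grid]), dominoWeight_vertical _ _ h01,
    Finset.erase_insert (by simp [mem_grid]),
    Finset.sum_eq_single_of_mem (0, k) (by simp [mem_grid]), dominoWeight_horizontal, hsub',
    ← gridPoly, ← gridPolyExtra]
  · ring
  · rintro ⟨q, i⟩ hq hne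
    rw [mem_grid] at hq
    rw [dominoWeight_eq_zero a b hq, map_zero, zero_mul]
    by_contra! hcon
    exact hne (by rw [← hcon.1, ← Nat.succ_injective hcon.2])

/-- The generating function over `k` of the matchings of the `2 × k` grid by weighted dominoes that
leave `2 * j` cells uncovered. -/
def gridSeries (a b : R) (j : ℕ) : R⟦X⟧ := mk fun k => (gridPoly a b k).coeff (2 * j)

/-- The generating function over `k` of the matchings of the `2 × k` grid with an additional cell
by weighted dominoes that leave `2 * j + 1` cells uncovered. -/
def gridSeriesExtra (a b : R) (j : ℕ) : R⟦X⟧ :=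
  mk fun k => (gridPolyExtra a b k).coeff (2 * j + 1)

/-- Generating function form of `gridPolyExtra_succ`; it eliminates the auxiliary series. -/
lemma gridSeriesExtra_mul (a b : R) (j : ℕ) :
    (1 - C b * X) * gridSeriesExtra a b j = gridSeries a b j := by
  ext k
  rw [sub_mul, one_mul, map_sub, mul_assoc, coeff_C_mul]
  rcases k with _ | k
  · rw [coeff_zero_X_mul]
    simp [gridSeriesExtra, gridSeries, gridPoly_zero, gridPolyExtra_zero, Polynomial.coeff_X,
      Polynomial.coeff_one]
  · rw [coeff_succ_X_mul]
    simp [gridSeriesExtra, gridSeries, gridPolyExtra_succ]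

lemma gridSeries_zero_mul (a b : R) :
    (1 - C a * X - C b ^ 2 * X ^ 2) * gridSeries a b 0 = 1 := by
  have h : (1 - C a * X - C b ^ 2 * X ^ 2) * gridSeries a b 0 = gridSeries a b 0 -
      C a * (X * gridSeries a b 0) - C (b ^ 2) * (X ^ 2 * gridSeries a b 0) := by
    rw [map_pow]; ring
  rw [h]
  ext k
  rw [map_sub, map_sub, coeff_C_mul, coeff_C_mul]
  rcases k with _ | _ | k
  · simp [gridSeries, gridPoly_zero]
  · rw [coeff_succ_X_mul, coeff_X_pow_mul', coeff_one]
    simp [gridSeries, gridPoly_one, gridPoly_zero]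
  · rw [coeff_succ_X_mul, coeff_X_pow_mul', if_pos (by omega), coeff_one]
    simp [gridSeries, gridPoly_add_two]
    ring

lemma gridSeries_succ_mul (a b : R) (j : ℕ) :
    (1 - C a * X - C b ^ 2 * X ^ 2) * gridSeries a b (j + 1) =
      X * (1 + C b * X) * gridSeriesExtra a b j := by
  have h : (1 - C a * X - C b ^ 2 * X ^ 2) * gridSeries a b (j + 1) = gridSeries a b (j + 1) -
      C a * (X * gridSeries a b (j + 1)) - C (b ^ 2) * (X ^ 2 * gridSeries a b (j + 1)) := by
    rw [map_pow]; ring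
  have h' : X * (1 + C b * X) * gridSeriesExtra a b j =
      X * gridSeriesExtra a b j + C b * (X ^ 2 * gridSeriesExtra a b j) := by
    ring
  rw [h, h']
  ext k
  rw [map_sub, map_sub, map_add, coeff_C_mul, coeff_C_mul, coeff_C_mul]
  have hj : 2 * (j + 1) = (2 * j + 1) + 1 := by ring
  rcases k with _ | _ | k
  · simp [gridSeries, gridPoly_zero, Polynomial.coeff_one]
  · rw [coeff_succ_X_mul, coeff_X_pow_mul', coeff_succ_X_mul, coeff_X_pow_mul']
    simp [gridSeries, gridSeriesExtra, gridPoly_one, hj]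
  · rw [coeff_succ_X_mul, coeff_X_pow_mul', if_pos (by omega), coeff_succ_X_mul,
      coeff_X_pow_mul', if_pos (by omega)]
    simp [gridSeries, gridSeriesExtra, gridPoly_add_two, hj]
    ring

/-- Passing from `j` to `j + 1` multiplies the series by `X (1 + bX) / ((1 - bX)(1 - aX - b²X²))`,
and the series at `j = 0` is `1 / (1 - aX - b²X²)`. -/
lemma gridSeries_mul (a b : R) (j : ℕ) :
    gridSeries a b j *
      ((1 - C b * X) ^ j * (1 - C a * X - C b ^ 2 * X ^ 2) ^ (j + 1)) =
        X ^ j * (1 + C b * X) ^ j := by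
  induction j with
  | zero => linear_combination gridSeries_zero_mul a b
  | succ j ih =>
    have h1 := gridSeries_succ_mul a b j
    have h2 := gridSeriesExtra_mul a b j
    calc _ = (1 - C a * X - C b ^ 2 * X ^ 2) * gridSeries a b (j + 1) * (1 - C b * X) *
          ((1 - C b * X) ^ j * (1 - C a * X - C b ^ 2 * X ^ 2) ^ (j + 1)) := by ring
      _ = X * (1 + C b * X) * (gridSeries a b j *
          ((1 - C b * X) ^ j * (1 - C a * X - C b ^ 2 * X ^ 2) ^ (j + 1))) := by
        rw [h1, ← h2]; ring
      _ = _ := by rw [ih]; ring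

lemma eq_mul_recip {f g h : R⟦X⟧} (hg : constantCoeff g = 1) (h' : f * g = h) :
    f = h * recip g := by
  rw [← h', mul_assoc, mul_recip g hg, mul_one]

lemma gridSeries_eq (a b : R) (j : ℕ) :
    gridSeries a b j = X ^ j * (1 + C b * X) ^ j *
      recip ((1 - C b * X) ^ j * (1 - C a * X - C b ^ 2 * X ^ 2) ^ (j + 1)) :=
  eq_mul_recip (by simp) (gridSeries_mul a b j)

lemma coeff_gridSeries_of_lt (a b : R) {j k : ℕ} (h : k < j) :
    coeff k (gridSeries a b j) = 0 := by
  rw [gridSeries_eq, mul_assoc, coeff_X_pow_mul', if_neg (by omega)]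

end Grid

/-! ### Configurations as perfect matchings of the grid -/

section Configurations

variable {R : Type*} [CommRing R]

lemma isConfiguration_iff {k : ℕ} (M : Finset (Sym2 (Cell k))) :
    IsConfiguration M ↔ IsPerfectMatchingOn Finset.univ M := by
  simp [IsConfiguration, IsPerfectMatchingOn]

/-- The polynomial `∑ D_{k,v,h} s^(k-v-h) w^v z^h`, in which each pair that is not a domino carries
the weight `s`. -/
def homDominoPoly (s w z : R) (k : ℕ) : R :=
  ∑ v ∈ Finset.range (k + 1), ∑ h ∈ Finset.range (k + 1),
    (dominoCount k v h : R) * (s ^ (k - v - h) * w ^ v * z ^ h)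

lemma homDominoPoly_one (w z : R) (k : ℕ) : homDominoPoly 1 w z k = dominoPoly w z k := by
  simp only [homDominoPoly, dominoPoly, one_pow, one_mul, mul_assoc]

/-- The embedding of the `2 × k` array into the two-row strip. -/
def cellEmbedding (k : ℕ) : Cell k ↪ Fin 2 × ℕ :=
  ⟨fun c => (c.1, c.2), fun c d h => by
    obtain ⟨c1, c2⟩ := c
    obtain ⟨d1, d2⟩ := d
    simp only [Prod.mk.injEq, Fin.val_inj] at h
    rw [h.1, h.2]⟩

lemma isVerticalPair_map {k : ℕ} (e : Sym2 (Cell k)) :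
    IsVerticalPair (e.map (cellEmbedding k)) ↔ IsVertical e := by
  induction e using Sym2.ind with
  | _ x y =>
    obtain ⟨r, i⟩ := x
    obtain ⟨r', j⟩ := y
    rw [Sym2.map_mk]
    refine isVerticalPair_mk.trans ?_
    simp only [IsVertical, Sym2.eq_iff, Prod.mk.injEq, Fin.val_inj]
    constructor
    · rintro ⟨h, rfl⟩
      refine ⟨i, ?_⟩
      fin_cases r <;> fin_cases r' <;> simp_all
    · rintro ⟨l, ⟨⟨rfl, rfl⟩, rfl, rfl⟩ | ⟨⟨rfl, rfl⟩, rfl, rfl⟩⟩ <;> simp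

lemma isHorizontalPair_map {k : ℕ} (e : Sym2 (Cell k)) :
    IsHorizontalPair (e.map (cellEmbedding k)) ↔ IsHorizontal e := by
  induction e using Sym2.ind with
  | _ x y =>
    obtain ⟨r, i⟩ := x
    obtain ⟨r', j⟩ := y
    rw [Sym2.map_mk]
    refine isHorizontalPair_mk.trans ?_
    simp only [IsHorizontal, Sym2.eq_iff, Prod.mk.injEq]
    constructor
    · rintro ⟨rfl, h | h⟩
      · exact ⟨r, i, j, h, by simp⟩
      · exact ⟨r, j, i, h, by simp⟩
    · rintro ⟨l, i', j', h, ⟨⟨rfl, rfl⟩, rfl, rfl⟩ | ⟨⟨rfl, rfl⟩, rfl, rfl⟩⟩ <;> simp [h]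

lemma not_isVertical_and_isHorizontal {k : ℕ} (e : Sym2 (Cell k)) :
    ¬ (IsVertical e ∧ IsHorizontal e) := by
  rw [← isVerticalPair_map, ← isHorizontalPair_map]
  generalize e.map (cellEmbedding k) = f
  induction f using Sym2.ind with
  | _ x y =>
    rw [isVerticalPair_mk, isHorizontalPair_mk]
    tauto

lemma numVertical_add_numHorizontal_le {k : ℕ} {M : Finset (Sym2 (Cell k))}
    (hM : IsConfiguration M) : numVertical M + numHorizontal M ≤ k := by
  classical
  by_contra! h
  have h0 := dominoCount_eq_zero h
  rw [dominoCount, Finset.card_eq_zero, Finset.filter_eq_empty_iff] at h0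
  exact h0 (Finset.mem_univ M) ⟨hM, rfl, rfl⟩

/-- Adding `s` back to the corrections gives the weights `w`, `z`, `s`. The exponent of `s` is the
number of remaining pairs, since a configuration has `k` pairs in all. -/
lemma prod_dominoWeight {k : ℕ} (s w z : R) {M : Finset (Sym2 (Cell k))}
    (hM : IsConfiguration M) :
    ∏ e ∈ M, (dominoWeight (w - s) (z - s) (e.map (cellEmbedding k)) + s) =
      s ^ (k - numVertical M - numHorizontal M) * w ^ numVertical M * z ^ numHorizontal M := by
  classical
  have hterm : ∀ e : Sym2 (Cell k),
      dominoWeight (w - s) (z - s) (e.map (cellEmbedding k)) + s =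
        if IsVertical e then w else if IsHorizontal e then z else s := by
    intro e
    simp only [dominoWeight, isVerticalPair_map, isHorizontalPair_map]
    split_ifs <;> ring
  have hfilter : (M.filter fun e => ¬ IsVertical e).filter IsHorizontal =
      M.filter IsHorizontal := by
    rw [Finset.filter_filter]
    refine Finset.filter_congr fun e _ => ?_
    have := not_isVertical_and_isHorizontal e
    tauto
  have hv : (M.filter IsVertical).card = numVertical M := by
    rw [numVertical]
  have hh : (M.filter IsHorizontal).card = numHorizontal M := by
    rw [numHorizontal]
  have h1 := Finset.card_filter_add_card_filter_not (s := M) IsVertical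
  have h2 := Finset.card_filter_add_card_filter_not
    (s := M.filter fun e => ¬ IsVertical e) IsHorizontal
  have h3 : ((M.filter fun e => ¬ IsVertical e).filter fun e => ¬ IsHorizontal e).card =
      k - numVertical M - numHorizontal M := by
    rw [hfilter, hh] at h2
    rw [hv, card_of_isConfiguration hM] at h1
    omega
  rw [Finset.prod_congr rfl fun e _ => hterm e, Finset.prod_ite, Finset.prod_ite,
    Finset.prod_const, Finset.prod_const, Finset.prod_const, hfilter, h3, hv, hh]
  ring

lemma homDominoPoly_eq_hafnian (s w z : R) (k : ℕ) :
    homDominoPoly s w z k =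
      hafnian (fun e => dominoWeight (w - s) (z - s) e + s) (grid k) := by
  classical
  have hgrid : grid k = Finset.univ.map (cellEmbedding k) := by
    ext ⟨r, i⟩
    simp only [mem_grid, Finset.mem_map, Finset.mem_univ, true_and]
    constructor
    · exact fun h => ⟨(r, ⟨i, h⟩), rfl⟩
    · rintro ⟨⟨r', i'⟩, h⟩
      rw [← (Prod.mk.inj h).2]
      exact i'.2
  rw [hgrid, hafnian_map, hafnian]
  have hprod : ∀ M ∈ perfectMatchings (Finset.univ : Finset (Cell k)),
      ∏ e ∈ M, (dominoWeight (w - s) (z - s) (e.map (cellEmbedding k)) + s) =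
      s ^ (k - numVertical M - numHorizontal M) * w ^ numVertical M * z ^ numHorizontal M :=
    fun M hM => prod_dominoWeight s w z
      ((isConfiguration_iff M).2 (mem_perfectMatchings.1 hM))
  have hmaps : ∀ M ∈ perfectMatchings (Finset.univ : Finset (Cell k)),
      (numVertical M, numHorizontal M) ∈ Finset.range (k + 1) ×ˢ Finset.range (k + 1) := by
    intro M hM
    have := numVertical_add_numHorizontal_le
      ((isConfiguration_iff M).2 (mem_perfectMatchings.1 hM))
    simp only [Finset.mem_product, Finset.mem_range]
    omega
  rw [Finset.sum_congr rfl hprod, ← Finset.sum_fiberwise_of_maps_to hmaps, Finset.sum_product]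
  refine Finset.sum_congr rfl fun v _ => Finset.sum_congr rfl fun h _ => ?_
  have hcard : dominoCount k v h = ((perfectMatchings (Finset.univ : Finset (Cell k))).filter
      fun M => (numVertical M, numHorizontal M) = (v, h)).card := by
    rw [dominoCount]
    congr 1
    ext M
    simp [mem_perfectMatchings, isConfiguration_iff]
  rw [hcard, ← nsmul_eq_mul, ← Finset.sum_const]
  refine Finset.sum_congr rfl fun M hM => ?_
  have := Prod.mk.inj (Finset.mem_filter.1 hM).2
  rw [this.1, this.2]

/-- The common source of all results: `s = 1` yields the series for `D`, while `s` a polynomial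
variable and `w = z = 1` yields the `𝓕_ℓ`. -/
lemma homDominoPoly_eq_sum (s w z : R) (k : ℕ) :
    homDominoPoly s w z k =
      ∑ j ∈ Finset.range (k + 1), ((Nat.doubleFactorial (2 * j - 1) : ℕ) : R) * s ^ j *
        coeff k (gridSeries (w - s) (z - s) j) := by
  rw [homDominoPoly_eq_hafnian, hafnian_const_add s _ _ k (by simp [grid])]
  simp only [gridSeries, coeff_mk, gridPoly]

end Configurations

/-! ### The formal series for `D` and its specialisations -/

section FormalSum

variable {R : Type*} [CommRing R]

lemma hasFormalSum_of_coeff {f : ℕ → R⟦X⟧} {S : R⟦X⟧} (h0 : ∀ k j, k < j → coeff k (f j) = 0)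
    (hS : ∀ k, coeff k S = ∑ j ∈ Finset.range (k + 1), coeff k (f j)) : HasFormalSum f S := by
  let _ : TopologicalSpace R := ⊥
  refine (PowerSeries.WithPiTopology.hasSum_iff_hasSum_coeff R).2 fun k => ?_
  rw [hS]
  refine hasSum_sum_of_ne_finset_zero fun j hj => h0 k j (by simpa using hj)

open scoped PowerSeries.WithPiTopology in
lemma HasFormalSum.mul_left {f : ℕ → R⟦X⟧} {S : R⟦X⟧} (h : HasFormalSum f S) (c : R⟦X⟧) :
    HasFormalSum (fun j => c * f j) (c * S) := by
  let _ : TopologicalSpace R := ⊥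
  have : DiscreteTopology R := ⟨rfl⟩
  exact HasSum.mul_left c h

lemma hasFormalSum_congr {f g : ℕ → R⟦X⟧} {S : R⟦X⟧} (h : HasFormalSum f S)
    (hfg : ∀ j, g j = f j) : HasFormalSum g S := by
  rwa [show g = f from funext hfg]

lemma coeff_oddFactorial_mul (j k : ℕ) (f : R⟦X⟧) :
    coeff k (oddFactorial j * f) = ((Nat.doubleFactorial (2 * j - 1) : ℕ) : R) * coeff k f := by
  rw [oddFactorial, ← map_natCast (C (R := R)), coeff_C_mul]

lemma coeff_dominoGF (w z : R) (k : ℕ) :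
    coeff k (dominoGF w z) = ∑ j ∈ Finset.range (k + 1),
      coeff k (oddFactorial j * gridSeries (w - 1) (z - 1) j) := by
  simp only [dominoGF, coeff_mk, ← homDominoPoly_one, homDominoPoly_eq_sum, one_pow, mul_one,
    coeff_oddFactorial_mul]

lemma hasFormalSum_dominoGF (w z : R) :
    HasFormalSum (fun j => oddFactorial j * gridSeries (w - 1) (z - 1) j) (dominoGF w z) :=
  hasFormalSum_of_coeff
    (fun k j h => by rw [coeff_oddFactorial_mul, coeff_gridSeries_of_lt _ _ h, mul_zero])
    (coeff_dominoGF w z)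

lemma gridSeries_sub_one (w z : R) (j : ℕ) :
    gridSeries (w - 1) (z - 1) j = X ^ j * (1 - C (1 - z) * X) ^ j *
      recip ((1 + C (1 - z) * X) ^ j *
        (1 + C (1 - w) * X - C (1 - z) ^ 2 * X ^ 2) ^ (j + 1)) := by
  rw [gridSeries_eq]
  have h1 : (1 + C (z - 1) * X : R⟦X⟧) = 1 - C (1 - z) * X := by
    simp only [map_sub, map_one]; ring
  have h2 : (1 - C (z - 1) * X : R⟦X⟧) = 1 + C (1 - z) * X := by
    simp only [map_sub, map_one]; ring
  have h3 : (1 - C (w - 1) * X - C (z - 1) ^ 2 * X ^ 2 : R⟦X⟧) =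
      1 + C (1 - w) * X - C (1 - z) ^ 2 * X ^ 2 := by
    simp only [map_sub, map_one]; ring
  rw [h1, h2, h3]

lemma hasFormalSum_dominoGF_explicit (w z : R) :
    HasFormalSum
      (fun j : ℕ => oddFactorial j * (X ^ j * (1 - C (1 - z) * X) ^ j) *
        recip ((1 + C (1 - z) * X) ^ j *
          (1 + C (1 - w) * X - C (1 - z) ^ 2 * X ^ 2) ^ (j + 1)))
      (dominoGF w z) :=
  hasFormalSum_congr (hasFormalSum_dominoGF w z) fun j => by
    rw [gridSeries_sub_one]; ring

lemma hasFormalSum_dominoGF_one_right (w : R) :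
    HasFormalSum (fun j : ℕ => oddFactorial j * X ^ j * recip ((1 + C (1 - w) * X) ^ (j + 1)))
      (dominoGF w 1) :=
  hasFormalSum_congr (hasFormalSum_dominoGF_explicit w 1) fun j => by simp

/-- At `w = 1` the quadratic factor splits as `(1 - (1-z)X)(1 + (1-z)X)`. The powers of `c = 1 -
(1-z)X` in numerator and denominator then cancel up to one factor `1/c`, so `S = c * D` works. -/
lemma hasFormalSum_dominoGF_one_left (z : R) :
    ∃ S : R⟦X⟧,
      HasFormalSum
        (fun j : ℕ => oddFactorial j * X ^ j * recip ((1 + C (1 - z) * X) ^ (2 * j + 1))) S ∧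
      dominoGF 1 z = recip (1 - C (1 - z) * X) * S := by
  set c : R⟦X⟧ := 1 - C (1 - z) * X with hc
  have hc1 : c * recip c = 1 := mul_recip c (by simp [hc])
  have hterm : ∀ j : ℕ, oddFactorial j * X ^ j * recip ((1 + C (1 - z) * X) ^ (2 * j + 1)) =
      c * (oddFactorial j * gridSeries (1 - 1) (z - 1) j) := by
    intro j
    have h1 := mul_recip ((1 + C (1 - z) * X) ^ (2 * j + 1) : R⟦X⟧) (by simp)
    have h2 := gridSeries_mul (1 - 1) (z - 1) j
    have h3 : (1 - C (1 - 1) * X - C (z - 1) ^ 2 * X ^ 2 : R⟦X⟧) =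
        c * (1 + C (1 - z) * X) := by
      simp only [hc, sub_self, map_sub, map_zero, map_one]; ring
    have h4 : (1 - C (z - 1) * X : R⟦X⟧) = 1 + C (1 - z) * X := by
      simp only [map_sub, map_one]; ring
    have h5 : (1 + C (z - 1) * X : R⟦X⟧) = c := by
      simp only [hc, map_sub, map_one]; ring
    rw [h3, h4, h5] at h2
    have h6 : c ^ j * recip c ^ j = 1 := by rw [← mul_pow, hc1, one_pow]
    have h7 : c * gridSeries (1 - 1) (z - 1) j * (1 + C (1 - z) * X) ^ (2 * j + 1) = X ^ j := by
      calc _ = c * gridSeries (1 - 1) (z - 1) j * (1 + C (1 - z) * X) ^ (2 * j + 1) *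
            (c ^ j * recip c ^ j) := by rw [h6, mul_one]
        _ = gridSeries (1 - 1) (z - 1) j * ((1 + C (1 - z) * X) ^ j *
            (c * (1 + C (1 - z) * X)) ^ (j + 1)) * recip c ^ j := by rw [mul_pow]; ring
        _ = X ^ j * (c ^ j * recip c ^ j) := by rw [h2]; ring
        _ = X ^ j := by rw [h6, mul_one]
    rw [← h7]
    linear_combination (oddFactorial j * c * gridSeries (1 - 1) (z - 1) j) * h1
  refine ⟨c * dominoGF 1 z, ?_, ?_⟩
  · exact hasFormalSum_congr ((hasFormalSum_dominoGF 1 z).mul_left c) hterm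
  · linear_combination (-dominoGF 1 z) * hc1

end FormalSum

/-! ### Taylor series of real functions -/

section TaylorSeries

/-- The Taylor series at `0` of a real function. -/
def taylorSeries (f : ℝ → ℝ) : ℝ⟦X⟧ := mk fun k => taylorCoeff k f

lemma taylorSeries_mul {f g : ℝ → ℝ} (hf : AnalyticAt ℝ f 0) (hg : AnalyticAt ℝ g 0) :
    taylorSeries (fun y => f y * g y) = taylorSeries f * taylorSeries g := by
  ext k
  rw [taylorSeries, coeff_mk, taylorCoeff, iteratedDeriv_fun_mul hf.contDiffAt hg.contDiffAt,
    coeff_mul, Finset.Nat.sum_antidiagonal_eq_sum_range_succ_mk, Finset.sum_div]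
  refine Finset.sum_congr rfl fun i hi => ?_
  have hik : i ≤ k := by simpa [Nat.lt_succ_iff] using hi
  simp only [taylorSeries, coeff_mk, taylorCoeff]
  rw [Nat.cast_choose ℝ hik]
  have h1 : (k.factorial : ℝ) ≠ 0 := by positivity
  have h2 : (i.factorial : ℝ) ≠ 0 := by positivity
  have h3 : ((k - i).factorial : ℝ) ≠ 0 := by positivity
  field_simp

lemma taylorSeries_add {f g : ℝ → ℝ} (hf : AnalyticAt ℝ f 0) (hg : AnalyticAt ℝ g 0) :
    taylorSeries (fun y => f y + g y) = taylorSeries f + taylorSeries g := by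
  ext k
  simp only [taylorSeries, coeff_mk, taylorCoeff, map_add]
  rw [iteratedDeriv_fun_add hf.contDiffAt hg.contDiffAt, add_div]

lemma taylorSeries_congr {f g : ℝ → ℝ} (h : f =ᶠ[nhds 0] g) :
    taylorSeries f = taylorSeries g := by
  ext k
  simp only [taylorSeries, coeff_mk, taylorCoeff, h.iteratedDeriv_eq]

lemma taylorSeries_polynomial (p : Polynomial ℝ) : taylorSeries (fun y => p.eval y) = p := by
  induction p using Polynomial.induction_on' with
  | add p q hp hq =>
    simp only [Polynomial.eval_add]
    rw [taylorSeries_add (AnalyticOnNhd.eval_polynomial p 0 trivial)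
      (AnalyticOnNhd.eval_polynomial q 0 trivial), hp, hq, Polynomial.coe_add]
  | monomial n c =>
    ext k
    simp only [taylorSeries, coeff_mk, taylorCoeff, Polynomial.eval_monomial,
      iteratedDeriv_const_mul_field, iteratedDeriv_fun_pow_zero, Polynomial.coeff_coe,
      Polynomial.coeff_monomial]
    split_ifs with h h' h'
    · subst h
      have : (k.factorial : ℝ) ≠ 0 := by positivity
      field_simp
    · exact absurd h.symm h'
    · exact absurd h'.symm h
    · simp

end TaylorSeries

/-! ### The formal series of `1/√(1-2X)` -/

section InverseSqrt

/-- The power series `∑ (2j-1)!!/j! X^j` of `1/√(1-2X)`. -/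
def invSqrtSeries : ℝ⟦X⟧ :=
  mk fun j => (Nat.doubleFactorial (2 * j - 1) : ℝ) / (j.factorial : ℝ)

lemma coeff_invSqrtSeries_succ (n : ℕ) :
    coeff (n + 1) invSqrtSeries * (n + 1) = (2 * n + 1) * coeff n invSqrtSeries := by
  have h1 : Nat.doubleFactorial (2 * (n + 1) - 1) =
      (2 * n + 1) * Nat.doubleFactorial (2 * n - 1) := by
    rcases n with _ | n
    · simp
    · rw [show 2 * (n + 1 + 1) - 1 = (2 * (n + 1) - 1) + 2 by omega,
        Nat.doubleFactorial_add_two]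
      congr 1
  have h2 : (n.factorial : ℝ) ≠ 0 := by positivity
  have h3 : (n : ℝ) + 1 ≠ 0 := by positivity
  simp only [invSqrtSeries, coeff_mk, h1, Nat.factorial_succ]
  push_cast
  field_simp

/-- The coefficient recurrence says `F' (1 - 2X) = F`, whence `F² (1 - 2X)` has derivative zero; its
constant term is `1`. -/
lemma invSqrtSeries_sq : invSqrtSeries ^ 2 * (1 - 2 * X) = 1 := by
  have hode : derivative ℝ invSqrtSeries * (1 - 2 * X) = invSqrtSeries := by
    have h : derivative ℝ invSqrtSeries * (1 - 2 * X) =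
        derivative ℝ invSqrtSeries - C (2 : ℝ) * (X * derivative ℝ invSqrtSeries) := by
      rw [map_ofNat]; ring
    rw [h]
    ext n
    rw [map_sub, coeff_C_mul, coeff_derivative, coeff_invSqrtSeries_succ]
    rcases n with _ | n
    · simp
    · rw [coeff_succ_X_mul, coeff_derivative]
      push_cast
      ring
  have hd : derivative ℝ (invSqrtSeries ^ 2 * (1 - 2 * X)) = 0 := by
    rw [Derivation.leibniz, Derivation.leibniz_pow]
    have h2 : derivative ℝ (1 - 2 * X : ℝ⟦X⟧) = -2 := by
      have : (1 - 2 * X : ℝ⟦X⟧) = 1 - (2 : ℝ) • X := by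
        rw [smul_eq_C_mul, map_ofNat]
      rw [this, map_sub, Derivation.map_smul, derivative_X, Derivation.map_one_eq_zero, smul_eq_C_mul,
        map_ofNat]
      ring
    rw [h2]
    simp only [smul_eq_mul, nsmul_eq_mul, Nat.cast_ofNat, Nat.add_one_sub_one, pow_one]
    linear_combination (2 * invSqrtSeries) * hode
  refine derivative.ext (by rw [hd, Derivation.map_one_eq_zero]) ?_
  simp [invSqrtSeries]

/-- Since `X ∣ b`, the powers of `b` beyond the `k`-th do not reach the coefficient of `X ^ k`, and
`f` may be truncated to a polynomial. -/
lemma coeff_mul_subst {K : Type*} [CommRing K] (f g b : K⟦X⟧) (hb : constantCoeff b = 0)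
    (k : ℕ) :
    coeff k (g * f.subst b) =
      ∑ j ∈ Finset.range (k + 1), coeff j f * coeff k (g * b ^ j) := by
  have hs : HasSubst b := HasSubst.of_constantCoeff_zero' hb
  have hX : X ^ (k + 1) ∣ b ^ (k + 1) := pow_dvd_pow_of_dvd (X_dvd_iff.2 hb) _
  obtain ⟨c, hc⟩ := hX
  have hf : f.subst b = b ^ (k + 1) * (mk fun i => coeff (i + (k + 1)) f).subst b +
      Polynomial.aeval b (trunc (k + 1) f) := by
    conv_lhs => rw [eq_X_pow_mul_shift_add_trunc (k + 1) f]
    rw [subst_add hs, subst_mul hs, subst_pow hs, subst_X hs, subst_coe hs]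
  rw [hf, mul_add, map_add, hc,
    show ∀ F : K⟦X⟧, g * (X ^ (k + 1) * c * F) = X ^ (k + 1) * (g * c * F) by intro F; ring,
    coeff_X_pow_mul', if_neg (by omega), zero_add,
    Polynomial.aeval_eq_sum_range' (natDegree_trunc_lt f k), Finset.mul_sum, map_sum]
  refine Finset.sum_congr rfl fun j hj => ?_
  rw [coeff_trunc, if_pos (Finset.mem_range.1 hj), mul_smul_comm, coeff_smul, smul_eq_mul]

end InverseSqrt

/-! ### The integral representation -/

section Laplace

variable (w z t : ℝ)

lemma laplaceKernel_radicand_analyticAt :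
    AnalyticAt ℝ (fun y : ℝ => 1 - 2 * t * y * (1 - (1 - z) * y) /
      ((1 + (1 - z) * y) * (1 + (1 - w) * y - (1 - z) ^ 2 * y ^ 2))) 0 := by
  refine AnalyticAt.sub analyticAt_const (AnalyticAt.div (by fun_prop) (by fun_prop) ?_)
  simp

lemma laplaceKernel_analyticAt : AnalyticAt ℝ (laplaceKernel w z t) 0 := by
  have h := laplaceKernel_radicand_analyticAt w z t
  have hs : AnalyticAt ℝ (fun y : ℝ => √(1 - 2 * t * y * (1 - (1 - z) * y) /
      ((1 + (1 - z) * y) * (1 + (1 - w) * y - (1 - z) ^ 2 * y ^ 2)))) 0 :=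
    -- The order `⊤` of differentiability is analyticity; the radicand equals `1` at `y = 0`, away
    -- from the singularity of the root.
    (h.contDiffAt (n := ⊤).sqrt (by simp)).analyticAt
  unfold laplaceKernel
  refine AnalyticAt.div analyticAt_const (AnalyticAt.mul (by fun_prop) hs) ?_
  simp

-- Squaring and clearing denominators leaves an identity near `0` in which, besides the kernel, only
-- polynomials occur, so no Taylor expansion of a root or a quotient has to be computed.
open Polynomial in
lemma taylorSeries_laplaceKernel_sq :
    taylorSeries (laplaceKernel w z t) ^ 2 *
      ((1 - PowerSeries.C (w - 1) * PowerSeries.X -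
          PowerSeries.C (z - 1) ^ 2 * PowerSeries.X ^ 2) *
        ((1 - PowerSeries.C (z - 1) * PowerSeries.X) *
          (1 - PowerSeries.C (w - 1) * PowerSeries.X -
            PowerSeries.C (z - 1) ^ 2 * PowerSeries.X ^ 2) -
          2 * PowerSeries.C t * PowerSeries.X *
            (1 + PowerSeries.C (z - 1) * PowerSeries.X))) =
      1 - PowerSeries.C (z - 1) * PowerSeries.X := by
  set q : ℝ[X] := 1 - Polynomial.C (w - 1) * Polynomial.X -
    Polynomial.C (z - 1) ^ 2 * Polynomial.X ^ 2 with hq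
  set p : ℝ[X] := 1 - Polynomial.C (z - 1) * Polynomial.X with hp
  set n : ℝ[X] := 1 + Polynomial.C (z - 1) * Polynomial.X with hn
  set m : ℝ[X] := q * (p * q - 2 * Polynomial.C t * Polynomial.X * n) with hm
  have hK := laplaceKernel_analyticAt w z t
  have hm_analytic : AnalyticAt ℝ (fun y => m.eval y) 0 :=
    AnalyticOnNhd.eval_polynomial m 0 trivial
  have hev : (fun y => laplaceKernel w z t y * laplaceKernel w z t y * m.eval y) =ᶠ[nhds 0]
      fun y => p.eval y := by
    have h1 : ∀ᶠ y in nhds (0 : ℝ), q.eval y ≠ 0 :=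
      q.continuous.continuousAt.eventually_ne (by simp [hq])
    have h2 : ∀ᶠ y in nhds (0 : ℝ), p.eval y ≠ 0 :=
      p.continuous.continuousAt.eventually_ne (by simp [hp])
    have h3 : ∀ᶠ y in nhds (0 : ℝ), 0 < 1 - 2 * t * y * (1 - (1 - z) * y) /
        ((1 + (1 - z) * y) * (1 + (1 - w) * y - (1 - z) ^ 2 * y ^ 2)) :=
      (laplaceKernel_radicand_analyticAt w z t).continuousAt.eventually_const_lt (by simp)
    filter_upwards [h1, h2, h3] with y hqy hpy hu
    have eq : q.eval y = 1 + (1 - w) * y - (1 - z) ^ 2 * y ^ 2 := by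
      simp [hq]; ring
    have ep : p.eval y = 1 + (1 - z) * y := by
      simp [hp]; ring
    have en : n.eval y = 1 - (1 - z) * y := by
      simp [hn]; ring
    have em : m.eval y = q.eval y * (p.eval y * q.eval y - 2 * t * y * n.eval y) := by
      simp [hm]
    rw [laplaceKernel, em]
    rw [← eq, ← ep, ← en] at hu ⊢
    set u := 1 - 2 * t * y * n.eval y / (p.eval y * q.eval y) with hu_def
    have hsq := Real.mul_self_sqrt hu.le
    have hs0 : √u ≠ 0 := (Real.sqrt_pos.2 hu).ne'
    have hpq : p.eval y * q.eval y - 2 * t * y * n.eval y = u * (p.eval y * q.eval y) := by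
      rw [hu_def]
      field_simp
    have key : ∀ x : ℝ, x * x = u → x ≠ 0 →
        1 / (q.eval y * x) * (1 / (q.eval y * x)) * (q.eval y * (u * (p.eval y * q.eval y))) =
          p.eval y := by
      intro x hxu hx
      rw [← hxu]
      field_simp
    rw [hpq]
    exact key _ hsq hs0
  have h := taylorSeries_congr hev
  rw [taylorSeries_mul (hK.fun_mul hK) hm_analytic, taylorSeries_mul hK hK,
    taylorSeries_polynomial, taylorSeries_polynomial] at h
  have h2 : ((2 : ℝ[X]) : ℝ⟦X⟧) = 2 := by
    rw [show (2 : ℝ[X]) = Polynomial.C 2 from rfl, Polynomial.coe_C, map_ofNat]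
  simpa [hm, hq, hp, hn, sq, h2] using h

/-- Both sides satisfy the same quadratic equation, whose leading coefficient is nonzero. As `ℝ⟦X⟧`
is a domain they agree up to sign, and both have constant term `1`. -/
lemma taylorSeries_laplaceKernel :
    taylorSeries (laplaceKernel w z t) =
      recip (1 - C (w - 1) * X - C (z - 1) ^ 2 * X ^ 2) *
        invSqrtSeries.subst (C t * (X * (1 + C (z - 1) * X) *
          recip ((1 - C (z - 1) * X) * (1 - C (w - 1) * X - C (z - 1) ^ 2 * X ^ 2)))) := by
  have hT := taylorSeries_laplaceKernel_sq w z t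
  have hT0 : constantCoeff (taylorSeries (laplaceKernel w z t)) = 1 := by
    rw [← coeff_zero_eq_constantCoeff_apply]
    simp [taylorSeries, taylorCoeff, laplaceKernel]
  set q : ℝ⟦X⟧ := 1 - C (w - 1) * X - C (z - 1) ^ 2 * X ^ 2 with hq
  set p : ℝ⟦X⟧ := 1 - C (z - 1) * X with hp
  set n : ℝ⟦X⟧ := 1 + C (z - 1) * X
  set b : ℝ⟦X⟧ := C t * (X * n * recip (p * q)) with hb
  have hb0 : constantCoeff b = 0 := by simp [hb]
  have hs : HasSubst b := HasSubst.of_constantCoeff_zero' hb0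
  set T := taylorSeries (laplaceKernel w z t)
  set F := invSqrtSeries.subst b with hF
  have hFsq : F ^ 2 * (1 - 2 * b) = 1 := by
    have h := congrArg (substAlgHom hs) invSqrtSeries_sq
    rw [map_mul, map_pow, map_sub, map_mul, map_one, map_ofNat, substAlgHom_X,
      coe_substAlgHom] at h
    exact h
  have hq1 : q * recip q = 1 := mul_recip q (by simp [hq])
  have hpq : p * q * recip (p * q) = 1 := mul_recip _ (by simp [hq, hp])
  set G := recip q * F with hG
  have hG0 : constantCoeff G = 1 := by
    have h := coeff_mul_subst invSqrtSeries (recip q) b hb0 0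
    rw [coeff_zero_eq_constantCoeff_apply] at h
    rw [hG, hF, h]
    simp [invSqrtSeries, recip]
  have hGsq : G ^ 2 * (q * (p * q - 2 * C t * X * n)) = p := by
    have h1 : p * q - 2 * C t * X * n = p * q * (1 - 2 * b) := by
      rw [hb]
      linear_combination (2 * C t * X * n) * hpq
    calc _ = p * (q * recip q) ^ 2 * (F ^ 2 * (1 - 2 * b)) := by rw [h1, hG]; ring
      _ = p := by rw [hq1, hFsq]; ring
  have hne : q * (p * q - 2 * C t * X * n) ≠ 0 := by
    intro h0
    have := congrArg constantCoeff h0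
    simp [hq, hp] at this
  have hsq : T ^ 2 = G ^ 2 := mul_right_cancel₀ hne (hT.trans hGsq.symm)
  rcases sq_eq_sq_iff_eq_or_eq_neg.1 hsq with h | h
  · exact h
  · have := congrArg constantCoeff h
    rw [map_neg, hT0, hG0] at this
    norm_num at this

/-- A polynomial in `t` for each `k`, so integrability against `e^{-t}` and termwise integration
need no limit argument. -/
lemma taylorCoeff_laplaceKernel (k : ℕ) :
    taylorCoeff k (laplaceKernel w z t) = ∑ j ∈ Finset.range (k + 1),
      (Nat.doubleFactorial (2 * j - 1) : ℝ) / (j.factorial : ℝ) * t ^ j *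
        coeff k (gridSeries (w - 1) (z - 1) j) := by
  have h : taylorCoeff k (laplaceKernel w z t) =
      coeff k (taylorSeries (laplaceKernel w z t)) := by
    rw [taylorSeries, coeff_mk]
  rw [h, taylorSeries_laplaceKernel, coeff_mul_subst _ _ _ (by simp)]
  refine Finset.sum_congr rfl fun j _ => ?_
  set q : ℝ⟦X⟧ := 1 - C (w - 1) * X - C (z - 1) ^ 2 * X ^ 2 with hq
  set p : ℝ⟦X⟧ := 1 - C (z - 1) * X with hp
  set n : ℝ⟦X⟧ := 1 + C (z - 1) * X with hn
  have hq1 : q * recip q = 1 := mul_recip q (by simp [hq])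
  have hpq : p * q * recip (p * q) = 1 := mul_recip _ (by simp [hq, hp])
  have hgrid : gridSeries (w - 1) (z - 1) j = recip q * (X * n * recip (p * q)) ^ j := by
    rw [gridSeries_eq, ← hq, ← hp, ← hn]
    symm
    refine eq_mul_recip (by simp [hq, hp]) ?_
    calc _ = (q * recip q) * (p * q * recip (p * q)) ^ j * (X ^ j * n ^ j) := by
          simp only [mul_pow, pow_succ]; ring
      _ = _ := by rw [hq1, hpq]; ring
  rw [mul_pow, ← map_pow, mul_left_comm, coeff_C_mul, ← hgrid, invSqrtSeries, coeff_mk,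
    mul_assoc]

lemma taylorCoeff_exp_mul_laplaceKernel (k : ℕ) :
    taylorCoeff k (fun y => Real.exp (-t) * laplaceKernel w z t y) =
      ∑ j ∈ Finset.range (k + 1), (Nat.doubleFactorial (2 * j - 1) : ℝ) / (j.factorial : ℝ) *
        coeff k (gridSeries (w - 1) (z - 1) j) * (Real.exp (-t) * t ^ j) := by
  have h := taylorCoeff_laplaceKernel w z t k
  rw [taylorCoeff] at h ⊢
  rw [iteratedDeriv_const_mul_field, mul_div_assoc, h, Finset.mul_sum]
  exact Finset.sum_congr rfl fun j _ => by ring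

lemma integrableOn_exp_neg_mul_pow (j : ℕ) :
    MeasureTheory.IntegrableOn (fun t : ℝ => Real.exp (-t) * t ^ j) (Set.Ioi 0) := by
  have h := Real.GammaIntegral_convergent (s := (j : ℝ) + 1) (by positivity)
  simpa using h

lemma integral_exp_neg_mul_pow (j : ℕ) :
    ∫ t in Set.Ioi (0 : ℝ), Real.exp (-t) * t ^ j = (j.factorial : ℝ) := by
  have h := Real.Gamma_eq_integral (s := (j : ℝ) + 1) (by positivity)
  rw [Real.Gamma_nat_eq_factorial] at h
  simpa using h.symm

lemma integrableOn_taylorCoeff_laplaceKernel (k : ℕ) :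
    MeasureTheory.IntegrableOn
      (fun t : ℝ => taylorCoeff k (fun y => Real.exp (-t) * laplaceKernel w z t y))
      (Set.Ioi 0) := by
  simp only [taylorCoeff_exp_mul_laplaceKernel]
  exact MeasureTheory.integrable_finsetSum _ fun j _ =>
    (integrableOn_exp_neg_mul_pow j).const_mul _

lemma integral_taylorCoeff_laplaceKernel (k : ℕ) :
    coeff k (dominoGF w z) = ∫ t in Set.Ioi (0 : ℝ),
      taylorCoeff k (fun y => Real.exp (-t) * laplaceKernel w z t y) := by
  simp only [taylorCoeff_exp_mul_laplaceKernel]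
  rw [MeasureTheory.integral_finsetSum _ fun j _ =>
    (integrableOn_exp_neg_mul_pow j).const_mul _, coeff_dominoGF]
  refine Finset.sum_congr rfl fun j _ => ?_
  rw [MeasureTheory.integral_const_mul, integral_exp_neg_mul_pow, coeff_oddFactorial_mul]
  have : (j.factorial : ℝ) ≠ 0 := by positivity
  field_simp

end Laplace

/-! ### Coefficients of `D(y/z,z,z)` in `z` -/

section Laurent

lemma coeff_dominoGFDiv_coeff (k : ℕ) (m : ℤ) :
    (coeff k dominoGFDiv).coeff m = ∑ v ∈ Finset.range (k + 1), ∑ h ∈ Finset.range (k + 1),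
      if (v : ℤ) + h - k = m then (dominoCount k v h : ℤ) else 0 := by
  have h1 : coeff k dominoGFDiv = ∑ v ∈ Finset.range (k + 1), ∑ h ∈ Finset.range (k + 1),
      LaurentPolynomial.C (dominoCount k v h : ℤ) *
        LaurentPolynomial.T ((v : ℤ) + h - k) := by
    rw [dominoGFDiv, coeff_rescale, dominoGF, coeff_mk, dominoPoly, Finset.mul_sum]
    refine Finset.sum_congr rfl fun v _ => ?_
    rw [Finset.mul_sum]
    refine Finset.sum_congr rfl fun h _ => ?_
    rw [LaurentPolynomial.T_pow, LaurentPolynomial.T_pow, LaurentPolynomial.T_pow, mul_assoc,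
      ← LaurentPolynomial.T_add, mul_left_comm, ← LaurentPolynomial.T_add]
    congr 2
    ring
  rw [h1, AddMonoidAlgebra.coeff_sum, Finset.sum_apply']
  refine Finset.sum_congr rfl fun v _ => ?_
  rw [AddMonoidAlgebra.coeff_sum, Finset.sum_apply']
  refine Finset.sum_congr rfl fun h _ => ?_
  rw [← LaurentPolynomial.single_eq_C_mul_T, AddMonoidAlgebra.coeff_single, Finsupp.single_apply]

lemma coeff_dominoGFDiv_coeff_of_pos (k : ℕ) (m : ℤ) (hm : 0 < m) :
    (coeff k dominoGFDiv).coeff m = 0 := by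
  rw [coeff_dominoGFDiv_coeff]
  refine Finset.sum_eq_zero fun v _ => Finset.sum_eq_zero fun h _ => ?_
  split_ifs with hvh
  · rw [dominoCount_eq_zero (by omega), Nat.cast_zero]
  · rfl

lemma coeff_dominoF_eq_sum (l k : ℕ) :
    coeff k (dominoF l) = ∑ v ∈ Finset.range (k + 1), ∑ h ∈ Finset.range (k + 1),
      if v + h + l = k then (dominoCount k v h : ℤ) else 0 := by
  rw [← Finset.sum_product', ← Finset.sum_filter, dominoF, coeff_mk]
  split_ifs with hlk
  · refine Finset.sum_congr ?_ fun _ _ => rfl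
    ext ⟨v, h⟩
    simp only [Finset.HasAntidiagonal.mem_antidiagonal, Finset.mem_filter, Finset.mem_product, Finset.mem_range]
    omega
  · symm
    refine Finset.sum_eq_zero fun p hp => ?_
    have := (Finset.mem_filter.1 hp).2
    omega

lemma coeff_dominoF_eq_coeff_dominoGFDiv (l k : ℕ) :
    coeff k (dominoF l) = (coeff k dominoGFDiv).coeff (-(l : ℤ)) := by
  rw [coeff_dominoF_eq_sum, coeff_dominoGFDiv_coeff]
  refine Finset.sum_congr rfl fun v _ => Finset.sum_congr rfl fun h _ => ?_
  refine if_congr ?_ rfl rfl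
  omega

end Laurent

/-! ### The series `𝓕_0`, `𝓕_1`, `𝓕_2` -/

section LowOrder

/-- The power series formed by the coefficients of `s ^ l`, where `s` is the polynomial
variable. -/
def layer (l : ℕ) (f : (Polynomial ℤ)⟦X⟧) : ℤ⟦X⟧ := mk fun k => (coeff k f).coeff l

lemma layer_mul (l : ℕ) (f g : (Polynomial ℤ)⟦X⟧) :
    layer l (f * g) =
      ∑ p ∈ Finset.HasAntidiagonal.antidiagonal l, layer p.1 f * layer p.2 g := by
  ext k
  simp only [layer, coeff_mk, coeff_mul, Polynomial.finsetSum_coeff, Polynomial.coeff_mul,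
    map_sum]
  rw [Finset.sum_comm]

lemma layer_zero_mul (f g : (Polynomial ℤ)⟦X⟧) :
    layer 0 (f * g) = layer 0 f * layer 0 g := by
  simp [layer_mul]

lemma layer_one_mul (f g : (Polynomial ℤ)⟦X⟧) :
    layer 1 (f * g) = layer 0 f * layer 1 g + layer 1 f * layer 0 g := by
  simp [layer_mul, Finset.Nat.antidiagonal_succ]

lemma layer_two_mul (f g : (Polynomial ℤ)⟦X⟧) :
    layer 2 (f * g) =
      layer 0 f * layer 2 g + layer 1 f * layer 1 g + layer 2 f * layer 0 g := by
  simp [layer_mul, Finset.Nat.antidiagonal_succ]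
  ring

lemma layer_add (l : ℕ) (f g : (Polynomial ℤ)⟦X⟧) :
    layer l (f + g) = layer l f + layer l g := by
  ext k; simp [layer]

lemma layer_sub (l : ℕ) (f g : (Polynomial ℤ)⟦X⟧) :
    layer l (f - g) = layer l f - layer l g := by
  ext k; simp [layer]

lemma layer_one (l : ℕ) : layer l 1 = if l = 0 then 1 else 0 := by
  ext k
  simp only [layer, coeff_mk, coeff_one]
  split_ifs <;> simp_all [Polynomial.coeff_one, coeff_one]

lemma layer_X (l : ℕ) : layer l X = if l = 0 then X else 0 := by
  ext k
  simp only [layer, coeff_mk, coeff_X]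
  split_ifs <;> simp_all [Polynomial.coeff_one, coeff_X]

lemma layer_C (l : ℕ) (p : Polynomial ℤ) : layer l (C p) = C (p.coeff l) := by
  ext k
  simp only [layer, coeff_mk, coeff_C]
  split_ifs <;> simp

/-- The grid series at the weights `1 - s`, where `s` is the polynomial variable. -/
def gridSeriesOneSub (j : ℕ) : (Polynomial ℤ)⟦X⟧ :=
  gridSeries (1 - Polynomial.X) (1 - Polynomial.X) j

lemma coeff_homDominoPoly_X (l k : ℕ) :
    (homDominoPoly Polynomial.X 1 1 k : Polynomial ℤ).coeff l = coeff k (dominoF l) := by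
  rw [coeff_dominoF_eq_sum, homDominoPoly, Polynomial.finsetSum_coeff]
  refine Finset.sum_congr rfl fun v _ => ?_
  rw [Polynomial.finsetSum_coeff]
  refine Finset.sum_congr rfl fun h _ => ?_
  rw [one_pow, one_pow, mul_one, mul_one, Polynomial.coeff_natCast_mul, Polynomial.coeff_X_pow]
  -- For `v + h > k` the exponent `k - v - h` truncates to `0`, which is harmless because the count
  -- vanishes.
  by_cases hk : k < v + h
  · rw [dominoCount_eq_zero hk]
    simp
  · rw [mul_ite, mul_one, mul_zero]
    refine if_congr ?_ rfl rfl
    omega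

/-- Only the grid series with at most `2 * l` uncovered cells contribute to `dominoF l`. -/
lemma dominoF_eq_sum_layer (l : ℕ) :
    dominoF l = ∑ j ∈ Finset.range (l + 1),
      ((Nat.doubleFactorial (2 * j - 1) : ℕ) : ℤ⟦X⟧) * layer (l - j) (gridSeriesOneSub j) := by
  ext k
  rw [← coeff_homDominoPoly_X, homDominoPoly_eq_sum, Polynomial.finsetSum_coeff, map_sum]
  have hterm : ∀ j : ℕ, ((((Nat.doubleFactorial (2 * j - 1) : ℕ) : Polynomial ℤ) *
      Polynomial.X ^ j * coeff k (gridSeries (1 - Polynomial.X) (1 - Polynomial.X) j)).coeff l) =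
      if j ≤ l then coeff k (((Nat.doubleFactorial (2 * j - 1) : ℕ) : ℤ⟦X⟧) *
        layer (l - j) (gridSeriesOneSub j)) else 0 := by
    intro j
    rw [mul_assoc, Polynomial.coeff_natCast_mul, Polynomial.coeff_X_pow_mul',
      ← map_natCast (C (R := ℤ)), coeff_C_mul, mul_ite, mul_zero, layer, coeff_mk,
      gridSeriesOneSub]
  have hlt : ∀ j : ℕ, k < j → coeff k (((Nat.doubleFactorial (2 * j - 1) : ℕ) : ℤ⟦X⟧) *
        layer (l - j) (gridSeriesOneSub j)) = 0 := by
    intro j hj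
    rw [← map_natCast (C (R := ℤ)), coeff_C_mul, layer, coeff_mk, gridSeriesOneSub,
      coeff_gridSeries_of_lt _ _ hj, Polynomial.coeff_zero, mul_zero]
  rw [Finset.sum_congr rfl fun j _ => hterm j, ← Finset.sum_filter]
  -- The range `j ≤ k` of the expansion and the range `j ≤ l` of the claim differ only by terms that
  -- vanish.
  refine Finset.sum_subset_zero_on_sdiff (fun j hj => ?_) (fun j hj => ?_) fun _ _ => rfl
  · simp only [Finset.mem_filter, Finset.mem_range] at hj ⊢
    omega
  · simp only [Finset.mem_sdiff, Finset.mem_filter, Finset.mem_range] at hj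
    exact hlt j (by omega)

/-- Comparison of powers of `s` in `gridSeries_zero_mul`, where at `a = b = 1 - s` the quadratic is
`(1 - X - X²) + s (X + 2X²) - s² X²`. -/
lemma layer_gridSeriesOneSub_zero :
    (1 - X - X ^ 2) * layer 0 (gridSeriesOneSub 0) = 1 ∧
    (1 - X - X ^ 2) * layer 1 (gridSeriesOneSub 0) +
      (X + 2 * X ^ 2) * layer 0 (gridSeriesOneSub 0) = 0 ∧
    (1 - X - X ^ 2) * layer 2 (gridSeriesOneSub 0) +
      (X + 2 * X ^ 2) * layer 1 (gridSeriesOneSub 0) -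
      X ^ 2 * layer 0 (gridSeriesOneSub 0) = 0 := by
  have h := gridSeries_zero_mul (1 - Polynomial.X : Polynomial ℤ) (1 - Polynomial.X)
  have h0 := congrArg (layer 0) h
  have h1 := congrArg (layer 1) h
  have h2 := congrArg (layer 2) h
  simp only [sq, layer_zero_mul, layer_one_mul, layer_two_mul, layer_sub, layer_one, layer_X,
    layer_C, Polynomial.coeff_sub, Polynomial.coeff_one, Polynomial.coeff_X] at h0 h1 h2
  norm_num at h0 h1 h2
  simp only [gridSeriesOneSub]
  refine ⟨?_, ?_, ?_⟩
  · linear_combination h0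
  · linear_combination h1
  · linear_combination h2

lemma gridSeries_succ_mul_gridSeries {R : Type*} [CommRing R] (a b : R) (j : ℕ) :
    (1 - C b * X) * (1 - C a * X - C b ^ 2 * X ^ 2) * gridSeries a b (j + 1) =
      X * (1 + C b * X) * gridSeries a b j := by
  rw [mul_assoc, gridSeries_succ_mul, ← gridSeriesExtra_mul]
  ring

/-- Orders `0` and `1` in `s` suffice: for `ℓ ≤ 2` a series with `j ≥ 1` enters only through its
layer `ℓ - j ≤ 1`. -/
lemma layer_gridSeriesOneSub_succ (j : ℕ) :
    (1 - X) * (1 - X - X ^ 2) * layer 0 (gridSeriesOneSub (j + 1)) =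
      X * (1 + X) * layer 0 (gridSeriesOneSub j) ∧
    (1 - X) * (1 - X - X ^ 2) * layer 1 (gridSeriesOneSub (j + 1)) +
      ((1 - X) * (X + 2 * X ^ 2) + X * (1 - X - X ^ 2)) * layer 0 (gridSeriesOneSub (j + 1)) =
      X * (1 + X) * layer 1 (gridSeriesOneSub j) - X ^ 2 * layer 0 (gridSeriesOneSub j) := by
  have h := gridSeries_succ_mul_gridSeries (1 - Polynomial.X : Polynomial ℤ) (1 - Polynomial.X) j
  have h0 := congrArg (layer 0) h
  have h1 := congrArg (layer 1) h
  simp only [sq, layer_zero_mul, layer_one_mul, layer_sub, layer_add, layer_one, layer_X,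
    layer_C, Polynomial.coeff_sub, Polynomial.coeff_one, Polynomial.coeff_X] at h0 h1
  norm_num at h0 h1
  simp only [gridSeriesOneSub]
  refine ⟨?_, ?_⟩
  · linear_combination h0
  · linear_combination h1

lemma dominoF_zero : dominoF 0 = recip (1 - X - X ^ 2) := by
  rw [dominoF_eq_sum_layer, ← one_mul (recip _)]
  refine eq_mul_recip (by simp) ?_
  obtain ⟨h, -, -⟩ := layer_gridSeriesOneSub_zero
  simp only [zero_add, Finset.sum_range_one]
  norm_num
  linear_combination h

lemma dominoF_one : dominoF 1 = 2 * X ^ 3 * recip ((1 - X) * (1 - X - X ^ 2) ^ 2) := by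
  rw [dominoF_eq_sum_layer]
  refine eq_mul_recip (by simp) ?_
  obtain ⟨h0, h1, -⟩ := layer_gridSeriesOneSub_zero
  obtain ⟨g0, -⟩ := layer_gridSeriesOneSub_succ 0
  simp only [Finset.sum_range_succ, Finset.sum_range_zero]
  norm_num at g0 ⊢
  -- The numerator comes out as `X(1 + X) - (1 - X)(X + 2X²) = 2X³`.
  linear_combination ((1 - X) * (1 - X - X ^ 2)) * h1 + (1 - X - X ^ 2) * g0 +
    (X * (1 + X) - (1 - X) * (X + 2 * X ^ 2)) * h0

lemma dominoF_two :
    dominoF 2 = X ^ 2 * (1 + 3 * X + 6 * X ^ 2 + X ^ 3 + 3 * X ^ 4) *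
      recip ((1 - X) ^ 2 * (1 - X - X ^ 2) ^ 3) := by
  rw [dominoF_eq_sum_layer]
  refine eq_mul_recip (by simp) ?_
  obtain ⟨h0, h1, h2⟩ := layer_gridSeriesOneSub_zero
  obtain ⟨g0, g1⟩ := layer_gridSeriesOneSub_succ 0
  obtain ⟨f0, -⟩ := layer_gridSeriesOneSub_succ 1
  simp only [Finset.sum_range_succ, Finset.sum_range_zero]
  norm_num [Nat.doubleFactorial] at f0 g0 g1 ⊢
  generalize layer 0 (gridSeriesOneSub 0) = a0 at *
  generalize layer 1 (gridSeriesOneSub 0) = a1 at *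
  generalize layer 2 (gridSeriesOneSub 0) = a2 at *
  generalize layer 0 (gridSeriesOneSub 1) = b0 at *
  generalize layer 1 (gridSeriesOneSub 1) = b1 at *
  generalize layer 0 (gridSeriesOneSub 2) = c0 at *
  set q : ℤ⟦X⟧ := 1 - X - X ^ 2 with hq
  set p : ℤ⟦X⟧ := 1 - X with hp
  -- The system is triangular: multiplying each unknown by its full denominator solves it without
  -- inverses. The target is `a2 + b1 + 3 c0`, with `3 = 3!!`.
  have e1 : q ^ 2 * a1 = -(X + 2 * X ^ 2) := by
    linear_combination q * h1 - (X + 2 * X ^ 2) * h0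
  have e2 : q ^ 3 * a2 = (X + 2 * X ^ 2) ^ 2 + X ^ 2 * q := by
    linear_combination q ^ 2 * h2 - (X + 2 * X ^ 2) * e1 + q * X ^ 2 * h0
  have e3 : p * q ^ 2 * b0 = X * (1 + X) := by
    linear_combination q * g0 + X * (1 + X) * h0
  have e4 : p ^ 2 * q ^ 3 * b1 = -p * (X * (1 + X) * (X + 2 * X ^ 2)) - X ^ 2 * p * q -
      (p * (X + 2 * X ^ 2) + X * q) * (X * (1 + X)) := by
    linear_combination p * q ^ 2 * g1 + p * X * (1 + X) * e1 - p * X ^ 2 * q * h0 -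
      (p * (X + 2 * X ^ 2) + X * q) * e3
  have e5 : p ^ 2 * q ^ 3 * c0 = (X * (1 + X)) ^ 2 := by
    linear_combination p * q ^ 2 * f0 + X * (1 + X) * e3
  have key : (a2 + b1 + 3 * c0) * (p ^ 2 * q ^ 3) =
      p ^ 2 * ((X + 2 * X ^ 2) ^ 2 + X ^ 2 * q) + (-p * (X * (1 + X) * (X + 2 * X ^ 2)) -
        X ^ 2 * p * q - (p * (X + 2 * X ^ 2) + X * q) * (X * (1 + X))) +
        3 * (X * (1 + X)) ^ 2 := by
    linear_combination p ^ 2 * e2 + e4 + 3 * e5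
  rw [key, hq, hp]
  ring

end LowOrder

end

theorem corollary3 :
    -- the formal series for `D(y,w,z)`
    (∀ (R : Type*) [CommRing R] (w z : R),
      HasFormalSum
        (fun j : ℕ =>
          oddFactorial j * (X ^ j * (1 - C (1 - z) * X) ^ j) *
            recip ((1 + C (1 - z) * X) ^ j *
              (1 + C (1 - w) * X - C (1 - z) ^ 2 * X ^ 2) ^ (j + 1)))
        (dominoGF w z)) ∧
    -- the integral for `D(y,w,z)`, acting on the Taylor expansion of the integrand in `y`
    (∀ w z : ℝ,
      (∀ t : ℝ, AnalyticAt ℝ (laplaceKernel w z t) 0) ∧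
      ∀ k : ℕ,
        MeasureTheory.IntegrableOn
          (fun t : ℝ => taylorCoeff k (fun y => Real.exp (-t) * laplaceKernel w z t y))
          (Set.Ioi 0) ∧
        coeff k (dominoGF w z) =
          ∫ t in Set.Ioi (0 : ℝ),
            taylorCoeff k (fun y => Real.exp (-t) * laplaceKernel w z t y)) ∧
    -- `D(y,w,1)`
    (∀ (R : Type*) [CommRing R] (w : R),
      HasFormalSum
        (fun j : ℕ => oddFactorial j * X ^ j * recip ((1 + C (1 - w) * X) ^ (j + 1)))
        (dominoGF w 1)) ∧
    -- `D(y,1,z)`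
    (∀ (R : Type*) [CommRing R] (z : R),
      ∃ S : R⟦X⟧,
        HasFormalSum
          (fun j : ℕ => oddFactorial j * X ^ j * recip ((1 + C (1 - z) * X) ^ (2 * j + 1))) S ∧
        dominoGF 1 z = recip (1 - C (1 - z) * X) * S) ∧
    -- `D(y,z,z)`
    (∀ (R : Type*) [CommRing R] (z : R),
      HasFormalSum
        (fun j : ℕ =>
          oddFactorial j * (X ^ j * (1 - C (1 - z) * X) ^ j) *
            recip ((1 + C (1 - z) * X) ^ j *
              (1 + C (1 - z) * X - C (1 - z) ^ 2 * X ^ 2) ^ (j + 1)))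
        (dominoGF z z)) ∧
    -- `𝓕_ℓ` as the coefficient of `z^{-ℓ}` in the expansion of `D(y/z,z,z)` at `z = ∞`,
    -- which has no positive powers of `z`
    (∀ (k : ℕ) (m : ℤ), 0 < m → (coeff k dominoGFDiv).coeff m = 0) ∧
    (∀ l k : ℕ, coeff k (dominoF l) = (coeff k dominoGFDiv).coeff (-(l : ℤ))) ∧
    -- the first three `𝓕_ℓ`
    dominoF 0 = recip (1 - X - X ^ 2) ∧
    dominoF 1 = 2 * X ^ 3 * recip ((1 - X) * (1 - X - X ^ 2) ^ 2) ∧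
    dominoF 2 =
      X ^ 2 * (1 + 3 * X + 6 * X ^ 2 + X ^ 3 + 3 * X ^ 4) *
        recip ((1 - X) ^ 2 * (1 - X - X ^ 2) ^ 3) := by
  exact ⟨fun R _ w z => hasFormalSum_dominoGF_explicit w z,
    fun w z => ⟨laplaceKernel_analyticAt w z, fun k =>
      ⟨integrableOn_taylorCoeff_laplaceKernel w z k, integral_taylorCoeff_laplaceKernel w z k⟩⟩,
    fun R _ w => hasFormalSum_dominoGF_one_right w,
    fun R _ z => hasFormalSum_dominoGF_one_left z,
    fun R _ z => hasFormalSum_dominoGF_explicit z z,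
    coeff_dominoGFDiv_coeff_of_pos,
    coeff_dominoF_eq_coeff_dominoGFDiv,
    dominoF_zero, dominoF_one, dominoF_two⟩
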